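/- Let $\omega_\alpha=(0,0)$, $\omega_\beta=(1,0)$, $\omega_\gamma=(1/2,\sqrt3/2)$, and let $\Delta\subset\mathbb{R}^2$ be the closed solid triangle with these vertices. A fractal gasket is the attractor $K$ (the unique nonempty compact set with $K=\bigcup_{j=1}^N\varphi_j(K)$) of an iterated function system $\varphi_j(z)=r_j(z+d_j)$, $j\in\Sigma=\{1,\dots,N\}$, with $r_j\in(0,1)$ and $d_j\in\mathbb{R}^2$, such that $\varphi_j(\Delta)\subset\Delta$ for all $j$ and, for $i\ne j$, every point of $\varphi_i(\Delta)\cap\varphi_j(\Delta)$ is a vertex of both triangles; the iterated function system is part of the data of the gasket. Let $\alpha$, $\beta$, $\gamma$ denote the symbols in $\Sigma$ (when they exist) with $\varphi_\alpha(\omega_\alpha)=\omega_\alpha$, $\varphi_\beta(\omega_\beta)=\omega_\beta$, $\varphi_\gamma(\omega_\gamma)=\omega_\gamma$. A horizontal block of $K$ is a set $I=\{i_1,\dots,i_k\}\subset\Sigma$ of $k$ distinct symbols with $\varphi_{i_j}(\omega_\beta)=\varphi_{i_{j+1}}(\omega_\alpha)$ for $1\le j\le k-1$ that is maximal under inclusion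 with this property; $k$ is its size. A horizontal block containing both $\alpha$ and $\beta$ is called the $\alpha\beta$-block. $K$ satisfies the top isolated condition if $\omega_\gamma\in K$ and $\varphi_\gamma(\Delta)\cap\varphi_j(\Delta)=\emptyset$ for all $j\neq\gamma$. Let $\mathcal{F}_{T,\alpha\beta}$ be the class of fractal gaskets $K$ such that (i) $K$ satisfies the top isolated condition or $\omega_\gamma\notin K$, and (ii) $\alpha$ and $\beta$ exist and belong to the same horizontal block. Theorem. Let $E,F\in\mathcal{F}_{T,\alpha\beta}$. Suppose that there is a size-preserving bijection from the collection of horizontal blocks of $E$ to that of $F$, and that the $\alpha\beta$-blocks of $E$ and $F$ have equal size. Then $E$ and $F$ are bi-Hölder equivalent, that is, there are a bijection $f:E\to F$ and constants $s>0$, $C>0$ with $$C^{-1}|x_1-x_2|^{1/s}\le |f(x_1)-f(x_2)|\le C|x_1-x_2|^{s}\qquad\text{for all }x_1,x_2\in E;$$ and $E$ and $F$ are homeomorphic. If in addition all contraction ratios of $E$ and of $F$ are equal to one number $r$, then $E$ and $F$ are Lipschitz equivalent, that is, there are a bijection $f:E\to F$ and $C>0$ with $C^{-1}|x_1-x_2|\le|f(x_1)-f(x_2)|\le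 C|x_1-x_2|$ for all $x_1,x_2\in E$. -/

import Mathlib

/-- The Euclidean plane. -/
abbrev Plane : Type := EuclideanSpace ℝ (Fin 2)

/-- The bottom left vertex `(0, 0)` of the triangle `Δ`. -/
noncomputable def omegaAlpha : Plane := !₂[0, 0]

/-- The bottom right vertex `(1, 0)` of the triangle `Δ`. -/
noncomputable def omegaBeta : Plane := !₂[1, 0]

/-- The top vertex `(1/2, √3/2)` of the triangle `Δ`. -/
noncomputable def omegaGamma : Plane := !₂[1 / 2, Real.sqrt 3 / 2]

/-- The set of the three vertices of `Δ`. -/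
def triangleVertices : Set Plane := {omegaAlpha, omegaBeta, omegaGamma}

/-- The (solid, closed) regular triangle `Δ`. -/
def triangle : Set Plane := convexHull ℝ triangleVertices

/-- A fractal gasket: the attractor `carrier` of an iterated function system
`φ_j(z) = r_j (z + d_j)`, `j ∈ Σ = Fin N`, with ratios in `(0, 1)`, such that the triangles
`φ_j(Δ)` lie in `Δ` and two different ones meet at most in common vertices. The first three laws
of `carrier` (nonempty, compact, self-similar) say that it is the attractor. -/
structure FractalGasket where
  N : ℕ
  ratio : Fin N → ℝ
  shift : Fin N → Plane
  ratio_mem : ∀ j, ratio j ∈ Set.Ioo (0 : ℝ) 1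
  carrier : Set Plane
  carrier_nonempty : carrier.Nonempty
  carrier_compact : IsCompact carrier
  carrier_eq : carrier = ⋃ j, (fun z : Plane => ratio j • (z + shift j)) '' carrier
  image_subset : ∀ j, (fun z : Plane => ratio j • (z + shift j)) '' triangle ⊆ triangle
  inter_subset : ∀ i j, i ≠ j →
    (fun z : Plane => ratio i • (z + shift i)) '' triangle ∩
        (fun z : Plane => ratio j • (z + shift j)) '' triangle ⊆
      (fun z : Plane => ratio i • (z + shift i)) '' triangleVertices ∩
        (fun z : Plane => ratio j • (z + shift j)) '' triangleVertices

namespace FractalGasket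

/-- The similitude `φ_j(z) = r_j (z + d_j)`. -/
noncomputable def map (K : FractalGasket) (j : Fin K.N) (z : Plane) : Plane :=
  K.ratio j • (z + K.shift j)

/-- The top isolated condition: the top vertex belongs to `K`, and the triangle `φ_γ(Δ)`, where `γ`
is the symbol with `φ_γ(ω_γ) = ω_γ`, is disjoint from all the other triangles `φ_j(Δ)`. -/
def TopIsolated (K : FractalGasket) : Prop :=
  omegaGamma ∈ K.carrier ∧
    ∃ c : Fin K.N, K.map c omegaGamma = omegaGamma ∧
      ∀ j, j ≠ c → Disjoint (K.map c '' triangle) (K.map j '' triangle)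

/-- `I` can be written as `{i_1, …, i_k}`, with distinct entries, such that
`φ_{i_j}(ω_β) = φ_{i_{j+1}}(ω_α)` for `1 ≤ j ≤ k - 1`. -/
def IsHorizontalRow (K : FractalGasket) (I : Finset (Fin K.N)) : Prop :=
  ∃ l : List (Fin K.N), l.Nodup ∧ l.toFinset = I ∧
    l.IsChain (fun i j => K.map i omegaBeta = K.map j omegaAlpha)

/-- A horizontal block: a row that is maximal with respect to inclusion. Its size is `I.card`. -/
def IsHorizontalBlock (K : FractalGasket) (I : Finset (Fin K.N)) : Prop :=
  Maximal K.IsHorizontalRow I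

/-- The `αβ`-block: a horizontal block that contains both the symbol `α` with
`φ_α(ω_α) = ω_α` and the symbol `β` with `φ_β(ω_β) = ω_β`. -/
def IsAlphaBetaBlock (K : FractalGasket) (I : Finset (Fin K.N)) : Prop :=
  K.IsHorizontalBlock I ∧
    (∃ a ∈ I, K.map a omegaAlpha = omegaAlpha) ∧ ∃ b ∈ I, K.map b omegaBeta = omegaBeta

/-- The class `F_{T, αβ}` of fractal gaskets. -/
def MemClassTAlphaBeta (K : FractalGasket) : Prop :=
  (K.TopIsolated ∨ omegaGamma ∉ K.carrier) ∧ ∃ I, K.IsAlphaBetaBlock I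

end FractalGasket

/-- `f` is a bi-Hölder map with index `s`. -/
def IsBiHolder {X Y : Type*} [MetricSpace X] [MetricSpace Y] (s : ℝ) (f : X → Y) : Prop :=
  Function.Bijective f ∧ ∃ C : ℝ, 0 < C ∧ ∀ x₁ x₂ : X,
    C⁻¹ * dist x₁ x₂ ^ (1 / s) ≤ dist (f x₁) (f x₂) ∧
      dist (f x₁) (f x₂) ≤ C * dist x₁ x₂ ^ s

/-- Hölder equivalence of metric spaces. -/
def HolderEquivalent (X Y : Type*) [MetricSpace X] [MetricSpace Y] : Prop :=
  ∃ f : X → Y, ∃ s : ℝ, 0 < s ∧ IsBiHolder s f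

/-- Lipschitz equivalence of metric spaces: Hölder equivalence with index `1`. -/
def LipschitzEquivalent (X Y : Type*) [MetricSpace X] [MetricSpace Y] : Prop :=
  ∃ f : X → Y, IsBiHolder 1 f

/-! Points of a gasket are coded by infinite words of symbols. Two words are `near` at level `n` if
their cells of level `n` coincide or touch in a point of the gasket. Near words have distance at
most a constant times `R ^ n` (`dist_code_le_of_near`), and words that are not near have distance at
least a constant times `ρ ^ n` (`exists_le_dist_code_of_not_near`), because cells without a common
point of the gasket have a gap and touching cells are transversal. So, up to powers, the metric is a
function of the combinatorial relation `near`, and two spaces coded by the same words with the same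
relation are bi-Hölder equivalent (`exists_isBiHolder_of_codings`).

A contact of two cells is either horizontal or involves the top of one of them. The horizontal
contacts are determined by the blocks and by the places of `α` and `β` in them. A size-preserving
bijection of blocks that matches the `αβ`-blocks therefore gives a bijection of symbols that
respects them (`exists_symbol_equiv_of_blocks`).

It remains to remove the contacts in which a cell `i` hangs by its top from the corner `side i` of a
cell `base i` (`exists_detach`). The pieces `T_m = base i · side i ^ m · free · top`, `m ≥ 1`, are
isolated and tend to that corner. The annuli `U_m` of words `i · top ^ (m + 2) · x` with `x 0 ≠ top`
fill the cell `i · top ^ 3` except for its tip. As in Hilbert's hotel, send `i · top ^ 3` to `T_1`,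
the top subcell of `T_m` to `T_(m+1)`, and the rest of `T_m` to `U_m`. Before the substitution `i`
does not touch `base i`; afterwards the annuli, which come from pieces tending to the corner, tend
to the tip, and so tip and corner are one point. All replaced prefixes keep their length, so `near`
changes only by a bounded number of levels (`Coder.near_apply`).

The Hölder exponent `s` only has to satisfy `R ≤ ρ' ^ s` and `R' ≤ ρ ^ s`; with all ratios equal, `s
= 1` is allowed. -/

open scoped RealInnerProductSpace

/-! ### Plane geometry of the triangle. -/

section Triangle

theorem inner_sub_vertices {u v w : Plane} (hu : u ∈ triangleVertices) (hv : v ∈ triangleVertices)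
    (hw : w ∈ triangleVertices) (hvw : v ≠ w) :
    (u = v ∧ ⟪u - v, w - v⟫ = 0) ∨ (‖u - v‖ = 1 ∧ 1 / 2 ≤ ⟪u - v, w - v⟫) := by
  have h3 : Real.sqrt 3 * Real.sqrt 3 = 3 := Real.mul_self_sqrt (by norm_num)
  simp only [triangleVertices, Set.mem_insert_iff, Set.mem_singleton_iff] at hu hv hw
  rcases hu with rfl | rfl | rfl <;> rcases hv with rfl | rfl | rfl <;>
    rcases hw with rfl | rfl | rfl <;>
    first
    | exact absurd rfl hvw
    | (left; simp; done)
    | (right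
       refine ⟨?_, ?_⟩
       · rw [EuclideanSpace.norm_eq, Real.sqrt_eq_one]
         simp [Fin.sum_univ_two, omegaAlpha, omegaBeta, omegaGamma]
         try nlinarith
       · rw [PiLp.inner_apply]
         simp [Fin.sum_univ_two, omegaAlpha, omegaBeta, omegaGamma]
         try nlinarith)

/-- The triangle lies in the cone of opening `120°` about each of its edges. -/
theorem half_norm_le_inner {z v w : Plane} (hz : z ∈ triangle) (hv : v ∈ triangleVertices)
    (hw : w ∈ triangleVertices) (hvw : v ≠ w) : ‖z - v‖ / 2 ≤ ⟪z - v, w - v⟫ := by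
  have hsub : triangle ⊆ {z : Plane | ‖z - v‖ / 2 ≤ ⟪z - v, w - v⟫} := by
    refine convexHull_min ?_ ?_
    · intro u hu
      rcases inner_sub_vertices hu hv hw hvw with ⟨rfl, h⟩ | ⟨h1, h2⟩
      · simp
      · simp only [Set.mem_ofPred_eq]; linarith
    · intro x hx y hy a b ha hb hab
      simp only [Set.mem_ofPred_eq] at *
      have e : a • x + b • y - v = a • (x - v) + b • (y - v) := by
        have : v = (a + b) • v := by rw [hab, one_smul]
        nth_rewrite 1 [this]; module
      rw [e, inner_add_left, inner_smul_left, inner_smul_left]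
      have h1 := norm_add_le (a • (x - v)) (b • (y - v))
      rw [norm_smul, norm_smul, Real.norm_of_nonneg ha, Real.norm_of_nonneg hb] at h1
      simp only [conj_trivial]
      nlinarith
  exact hsub hz

theorem norm_sub_vertices {v w : Plane} (hv : v ∈ triangleVertices) (hw : w ∈ triangleVertices)
    (hvw : v ≠ w) : ‖w - v‖ = 1 := by
  rcases inner_sub_vertices hw hv hw hvw with h | h
  · exact absurd h.1.symm hvw
  · exact h.1

theorem omegaAlpha_mem : omegaAlpha ∈ triangleVertices := by simp [triangleVertices]
theorem omegaBeta_mem : omegaBeta ∈ triangleVertices := by simp [triangleVertices]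
theorem omegaGamma_mem : omegaGamma ∈ triangleVertices := by simp [triangleVertices]

theorem omegaAlpha_ne_omegaBeta : omegaAlpha ≠ omegaBeta := fun h => by
  simpa [omegaAlpha, omegaBeta] using congrArg (fun z : Plane => z 0) h

theorem omegaAlpha_ne_omegaGamma : omegaAlpha ≠ omegaGamma := fun h => by
  simpa [omegaAlpha, omegaGamma] using congrArg (fun z : Plane => z 0) h

theorem omegaBeta_ne_omegaGamma : omegaBeta ≠ omegaGamma := fun h => by
  have := congrArg (fun z : Plane => z 0) h
  norm_num [omegaBeta, omegaGamma] at this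

theorem exists_vertex_ne (v : Plane) : ∃ w ∈ triangleVertices, v ≠ w := by
  by_cases h : v = omegaAlpha
  · exact ⟨omegaBeta, omegaBeta_mem, h ▸ omegaAlpha_ne_omegaBeta⟩
  · exact ⟨omegaAlpha, omegaAlpha_mem, h⟩

theorem triangleVertices_subset : triangleVertices ⊆ triangle := subset_convexHull ℝ _

theorem convex_triangle : Convex ℝ triangle := convex_convexHull ℝ _

theorem isCompact_triangle : IsCompact triangle :=
  Set.Finite.isCompact_convexHull ℝ (by simp [triangleVertices])

theorem height_nonneg {z : Plane} (hz : z ∈ triangle) : 0 ≤ z 1 := by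
  have hsub : triangle ⊆ {z : Plane | 0 ≤ z 1} := by
    refine convexHull_min ?_ ?_
    · rintro u (rfl | rfl | rfl)
      · simp [omegaAlpha]
      · simp [omegaBeta]
      · simp only [omegaGamma, Set.mem_ofPred_eq]
        simp; positivity
    · intro x hx y hy a b ha hb _
      simp only [Set.mem_ofPred_eq, PiLp.add_apply, PiLp.smul_apply, smul_eq_mul] at *
      positivity
  exact hsub hz

theorem norm_sub_le_one_of_mem_triangle {z v : Plane} (hz : z ∈ triangle)
    (hv : v ∈ triangleVertices) : ‖z - v‖ ≤ 1 := by
  have hsub : triangle ⊆ Metric.closedBall v 1 := by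
    refine convexHull_min ?_ (convex_closedBall _ _)
    intro u hu
    rw [Metric.mem_closedBall, dist_eq_norm]
    by_cases h : v = u
    · simp [h]
    · exact (norm_sub_vertices hv hu h).le
  simpa [dist_eq_norm] using hsub hz

end Triangle

/-! ### Cells of a gasket and their corners. -/

namespace FractalGasket

variable (K : FractalGasket)

theorem ratio_pos (j : Fin K.N) : 0 < K.ratio j := (K.ratio_mem j).1
theorem ratio_lt_one (j : Fin K.N) : K.ratio j < 1 := (K.ratio_mem j).2

theorem map_sub (j : Fin K.N) (z w : Plane) : K.map j z - K.map j w = K.ratio j • (z - w) := by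
  simp only [map]; module

theorem dist_map (j : Fin K.N) (z w : Plane) :
    dist (K.map j z) (K.map j w) = K.ratio j * dist z w := by
  rw [dist_eq_norm, map_sub, norm_smul, Real.norm_of_nonneg (K.ratio_pos j).le, dist_eq_norm]

theorem map_injective (j : Fin K.N) : Function.Injective (K.map j) := fun z w h => by
  have := K.dist_map j z w
  rw [h, dist_self] at this
  have h2 := (mul_eq_zero.1 this.symm).resolve_left (K.ratio_pos j).ne'
  exact dist_eq_zero.1 h2

theorem continuous_map (j : Fin K.N) : Continuous (K.map j) := by
  unfold map; fun_prop

theorem map_mem_triangle (j : Fin K.N) {z : Plane} (hz : z ∈ triangle) : K.map j z ∈ triangle :=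
  K.image_subset j ⟨z, hz, rfl⟩

theorem map_mem_carrier (j : Fin K.N) {z : Plane} (hz : z ∈ K.carrier) :
    K.map j z ∈ K.carrier := by
  rw [K.carrier_eq]; exact Set.mem_iUnion.2 ⟨j, z, hz, rfl⟩

theorem exists_map_eq {z : Plane} (hz : z ∈ K.carrier) : ∃ j, ∃ y ∈ K.carrier, K.map j y = z := by
  rw [K.carrier_eq] at hz
  obtain ⟨j, y, hy, h⟩ := Set.mem_iUnion.1 hz
  exact ⟨j, y, hy, h⟩

/-- A point of `K` farthest from the triangle is the image of a point of `K` under a contraction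
that preserves the triangle, so the maximal distance is at most a proper fraction of itself. -/
theorem carrier_subset : K.carrier ⊆ triangle := by
  obtain ⟨z, hz, hmax⟩ := K.carrier_compact.exists_isMaxOn K.carrier_nonempty
    (Metric.continuous_infDist_pt triangle).continuousOn
  have htri : triangle.Nonempty := ⟨_, triangleVertices_subset omegaAlpha_mem⟩
  obtain ⟨j, y, hy, hyz⟩ := K.exists_map_eq hz
  obtain ⟨p, hp, hpd⟩ := isCompact_triangle.exists_infDist_eq_dist htri y
  have h1 : Metric.infDist z triangle ≤ K.ratio j * Metric.infDist y triangle := by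
    rw [hpd, ← K.dist_map, hyz]
    exact Metric.infDist_le_dist_of_mem (K.map_mem_triangle j hp)
  have h2 : Metric.infDist y triangle ≤ Metric.infDist z triangle := hmax hy
  have h3 : Metric.infDist z triangle = 0 := by
    have := Metric.infDist_nonneg (x := z) (s := triangle)
    have h4 := K.ratio_lt_one j
    have h5 := K.ratio_pos j
    nlinarith
  intro x hx
  have h4 : Metric.infDist x triangle ≤ Metric.infDist z triangle := hmax hx
  rw [isCompact_triangle.isClosed.mem_iff_infDist_zero htri]
  exact le_antisymm (h3 ▸ h4) Metric.infDist_nonneg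

variable {K}

/-- If `φ_j(z) = v`, then `φ_j(v) - v` is a negative multiple of `z - v`. Both `z` and `φ_j(v)` lie
in the cone of the triangle at `v`, and this cone contains no two opposite nonzero vectors. -/
theorem eq_of_map_eq_vertex {j : Fin K.N} {z v : Plane} (hz : z ∈ triangle)
    (hv : v ∈ triangleVertices) (h : K.map j z = v) : z = v := by
  obtain ⟨w, hw, hvw⟩ := exists_vertex_ne v
  have h1 := half_norm_le_inner (K.map_mem_triangle j (triangleVertices_subset hv)) hv hw hvw
  have h2 := half_norm_le_inner hz hv hw hvw
  have h3 : K.map j v - v = (-K.ratio j) • (z - v) := by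
    nth_rewrite 2 [← h]; rw [K.map_sub]; module
  rw [h3, inner_smul_left, norm_smul, norm_neg, Real.norm_of_nonneg (K.ratio_pos j).le] at h1
  simp only [map_neg, conj_trivial] at h1
  have h4 := K.ratio_pos j
  have h5 : ‖z - v‖ ≤ 0 := by
    by_contra hc
    push Not at hc
    nlinarith [mul_pos h4 hc, mul_le_mul_of_nonneg_left h2 h4.le]
  exact sub_eq_zero.1 (norm_le_zero_iff.1 h5)

/-- Two cells with a common corner of the same kind are nested there, so the midpoint of an edge of
the smaller one lies in both. It is not a vertex, against `inter_subset`. Hence every vertex has at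
most one fixing symbol, and touching cells meet in corners of different kinds. -/
theorem eq_of_map_vertex_eq {s t : Fin K.N} {v : Plane} (hv : v ∈ triangleVertices)
    (h : K.map s v = K.map t v) : s = t := by
  wlog hle : K.ratio s ≤ K.ratio t generalizing s t
  · exact (this h.symm (le_of_not_ge hle)).symm
  by_contra hst
  obtain ⟨w, hw, hvw⟩ := exists_vertex_ne v
  have hv' := triangleVertices_subset hv
  have hw' := triangleVertices_subset hw
  have hmid : (1 / 2 : ℝ) • v + (1 / 2 : ℝ) • w ∈ triangle :=
    convex_triangle hv' hw' (by norm_num) (by norm_num) (by norm_num)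
  -- The midpoint of the edge from `v` to `w` in the smaller cell `s` sits at the fraction `q / 2`
  -- of the same edge in the cell `t`.
  set q := K.ratio s / K.ratio t with hq
  have hs := K.ratio_pos s
  have ht := K.ratio_pos t
  have hq0 : 0 < q := div_pos hs ht
  have hq1 : q ≤ 1 := (div_le_one ht).2 hle
  have hmid2 : (1 - q / 2) • v + (q / 2) • w ∈ triangle :=
    convex_triangle hv' hw' (by linarith) (by linarith) (by ring)
  have he : K.map s ((1 / 2 : ℝ) • v + (1 / 2 : ℝ) • w)
      = K.map t ((1 - q / 2) • v + (q / 2) • w) := by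
    have e1 := K.map_sub s ((1 / 2 : ℝ) • v + (1 / 2 : ℝ) • w) v
    have e2 := K.map_sub t ((1 - q / 2) • v + (q / 2) • w) v
    have e3 : K.ratio s • ((1 / 2 : ℝ) • v + (1 / 2 : ℝ) • w - v)
        = K.ratio t • ((1 - q / 2) • v + (q / 2) • w - v) := by
      have : K.ratio s = K.ratio t * q := by rw [hq]; field_simp
      rw [this]; module
    rw [sub_eq_iff_eq_add] at e1 e2
    rw [e1, e2, e3, h]
  obtain ⟨⟨u, hu, hu'⟩, -⟩ := K.inter_subset s t hst ⟨⟨_, hmid, rfl⟩, ⟨_, hmid2, he.symm⟩⟩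
  have hum : u = (1 / 2 : ℝ) • v + (1 / 2 : ℝ) • w := K.map_injective s hu'
  have hn : ‖u - v‖ = 1 / 2 := by
    have : u - v = (1 / 2 : ℝ) • (w - v) := by rw [hum]; module
    rw [this, norm_smul, norm_sub_vertices hv hw hvw]; norm_num
  by_cases huv : v = u
  · rw [huv, sub_self, norm_zero] at hn; norm_num at hn
  · rw [norm_sub_vertices hv hu huv] at hn; norm_num at hn

theorem fixed_unique {a : Fin K.N} {v w : Plane} (h : K.map a v = v) (h' : K.map a w = w) :
    v = w := by
  have := K.dist_map a v w
  rw [h, h'] at this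
  have h1 := K.ratio_lt_one a
  have h2 : dist v w = 0 := by nlinarith [dist_nonneg (x := v) (y := w)]
  exact dist_eq_zero.1 h2

theorem exists_fixing {v : Plane} (hv : v ∈ triangleVertices) (hK : v ∈ K.carrier) :
    ∃ a, K.map a v = v := by
  obtain ⟨a, y, hy, h⟩ := K.exists_map_eq hK
  have := eq_of_map_eq_vertex (K.carrier_subset hy) hv h
  exact ⟨a, this ▸ h⟩

/-- Two cells that meet in a vertex `q` are transversal there. -/
theorem dist_ge_of_touch {s t : Fin K.N} {v w x y : Plane} (hv : v ∈ triangleVertices)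
    (hw : w ∈ triangleVertices) (hvw : v ≠ w) (h : K.map s v = K.map t w)
    (hx : x ∈ triangle) (hy : y ∈ triangle) :
    (dist (K.map s x) (K.map s v) + dist (K.map t y) (K.map t w)) / 2
      ≤ dist (K.map s x) (K.map t y) := by
  have h1 := half_norm_le_inner hx hv hw hvw
  have h2 := half_norm_le_inner hy hw hv hvw.symm
  have hs := K.ratio_pos s
  have ht := K.ratio_pos t
  have e : K.map s x - K.map t y = K.ratio s • (x - v) - K.ratio t • (y - w) := by
    rw [← K.map_sub, ← K.map_sub, h]; abel
  -- Project on the edge direction `w - v`: seen from the common point, the cells lie on opposite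
  -- sides, so their projections add up, and each is at least half of the distance.
  have h3 : ⟪K.map s x - K.map t y, w - v⟫ ≤ ‖K.map s x - K.map t y‖ * ‖w - v‖ :=
    real_inner_le_norm _ _
  have h4 : ⟪y - w, w - v⟫ = -⟪y - w, v - w⟫ := by rw [← inner_neg_right]; simp
  rw [norm_sub_vertices hv hw hvw, e, inner_sub_left, inner_smul_left, inner_smul_left, h4] at h3
  simp only [conj_trivial] at h3
  rw [K.dist_map, K.dist_map, dist_eq_norm, dist_eq_norm, dist_eq_norm, e]
  nlinarith [mul_le_mul_of_nonneg_left h1 hs.le, mul_le_mul_of_nonneg_left h2 ht.le]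

end FractalGasket

/-! ### Infinite words and the relation `near`. -/

section Words

variable {S : Type*}

/-- Prepend a letter to an infinite word. -/
def wcons (s : S) (x : ℕ → S) : ℕ → S
  | 0 => s
  | n + 1 => x n

/-- Remove the first letter of an infinite word. -/
def wtail (x : ℕ → S) : ℕ → S := fun n => x (n + 1)

@[simp] theorem wcons_zero (s : S) (x : ℕ → S) : wcons s x 0 = s := rfl
@[simp] theorem wcons_succ (s : S) (x : ℕ → S) (n : ℕ) : wcons s x (n + 1) = x n := rfl
@[simp] theorem wtail_wcons (s : S) (x : ℕ → S) : wtail (wcons s x) = x := rfl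
@[simp] theorem wtail_apply (x : ℕ → S) (n : ℕ) : wtail x n = x (n + 1) := rfl

theorem wcons_wtail (x : ℕ → S) : wcons (x 0) (wtail x) = x := by
  funext n; cases n <;> rfl

theorem wcons_inj {s t : S} {x y : ℕ → S} (h : wcons s x = wcons t y) : s = t ∧ x = y :=
  ⟨congrFun h 0, congrArg wtail h⟩

/-- The first `n` letters of `x` equal `a`. -/
def run (a : S) (n : ℕ) (x : ℕ → S) : Prop := ∀ k < n, x k = a

theorem run_zero (a : S) (x : ℕ → S) : run a 0 x := fun _ h => absurd h (Nat.not_lt_zero _)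

theorem run_succ {a : S} {n : ℕ} {x : ℕ → S} : run a (n + 1) x ↔ x 0 = a ∧ run a n (wtail x) := by
  constructor
  · exact fun h => ⟨h 0 n.succ_pos, fun k hk => h (k + 1) (by omega)⟩
  · rintro ⟨h0, h⟩ k hk
    cases k with
    | zero => exact h0
    | succ k => exact h k (by omega)

theorem run.mono {a : S} {n m : ℕ} {x : ℕ → S} (h : run a n x) (hm : m ≤ n) : run a m x :=
  fun k hk => h k (by omega)

/-- The cells of level `n` of the words `x` and `y` coincide or touch, where `C s a t b` says that
the cells of `s` and `t` touch in the corner of type `a` of the first, and `b` of the second. -/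
def near (C : S → S → S → S → Prop) : ℕ → (ℕ → S) → (ℕ → S) → Prop
  | 0, _, _ => True
  | n + 1, x, y => (x 0 = y 0 ∧ near C n (wtail x) (wtail y)) ∨
      ∃ a b, C (x 0) a (y 0) b ∧ run a n (wtail x) ∧ run b n (wtail y)

theorem near.pred {C : S → S → S → S → Prop} {n : ℕ} {x y : ℕ → S} (h : near C (n + 1) x y) :
    near C n x y := by
  induction n generalizing x y with
  | zero => trivial
  | succ n ih =>
    rcases h with ⟨h0, h1⟩ | ⟨a, b, hc, ha, hb⟩
    · exact Or.inl ⟨h0, ih h1⟩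
    · exact Or.inr ⟨a, b, hc, ha.mono n.le_succ, hb.mono n.le_succ⟩

theorem near.anti {C : S → S → S → S → Prop} {n m : ℕ} {x y : ℕ → S} (h : near C n x y)
    (hm : m ≤ n) : near C m x y := by
  induction n, hm using Nat.le_induction with
  | base => exact h
  | succ n _ ih => exact ih h.pred

theorem near_refl (C : S → S → S → S → Prop) (n : ℕ) (x : ℕ → S) : near C n x x := by
  induction n generalizing x with
  | zero => trivial
  | succ n ih => exact Or.inl ⟨rfl, ih _⟩

theorem near.imp {C D : S → S → S → S → Prop} (hCD : ∀ s a t b, C s a t b → D s a t b) {n : ℕ}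
    {x y : ℕ → S} (h : near C n x y) : near D n x y := by
  induction n generalizing x y with
  | zero => trivial
  | succ n ih =>
    rcases h with ⟨h0, h1⟩ | ⟨a, b, hc, h⟩
    · exact Or.inl ⟨h0, ih h1⟩
    · exact Or.inr ⟨a, b, hCD _ _ _ _ hc, h⟩

theorem near.symm {C : S → S → S → S → Prop} (hC : ∀ s a t b, C s a t b → C t b s a) {n : ℕ}
    {x y : ℕ → S} (h : near C n x y) : near C n y x := by
  induction n generalizing x y with
  | zero => trivial
  | succ n ih =>
    rcases h with ⟨h0, h1⟩ | ⟨a, b, hc, ha, hb⟩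
    · exact Or.inl ⟨h0.symm, ih h1⟩
    · exact Or.inr ⟨b, a, hC _ _ _ _ hc, hb, ha⟩

end Words

theorem exists_pos_forall {ι : Type*} [Finite ι] {P : ι → ℝ → Prop}
    (mono : ∀ i a b, a ≤ b → P i b → P i a) (h : ∀ i, ∃ c > 0, P i c) :
    ∃ c > 0, ∀ i, P i c := by
  choose c hc hP using h
  cases isEmpty_or_nonempty ι
  · exact ⟨1, one_pos, fun i => isEmptyElim i⟩
  · obtain ⟨i, hi⟩ := Finite.exists_min c
    exact ⟨c i, hc i, fun j => mono j _ _ (hi j) (hP j)⟩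

theorem eq_zero_of_forall_le_pow {a B R : ℝ} (ha : 0 ≤ a) (hR : 0 ≤ R) (hR1 : R < 1)
    (h : ∀ n : ℕ, a ≤ R ^ n * B) : a = 0 := by
  have := (tendsto_pow_atTop_nhds_zero_of_lt_one hR hR1).mul_const B
  rw [zero_mul] at this
  exact le_antisymm (ge_of_tendsto' this h) ha

/-! ### The coding map, and distances in terms of `near`. -/

namespace FractalGasket

variable (K : FractalGasket)

/-- The cells of `s ≠ t` meet in a point that is the vertex of type `a` of the first and of type `b`
of the second; the type of a vertex is the symbol of the cell of `K` at this vertex. -/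
def Contact (s a t b : Fin K.N) : Prop :=
  s ≠ t ∧ ∃ v ∈ triangleVertices, ∃ w ∈ triangleVertices,
    K.map a v = v ∧ K.map b w = w ∧ K.map s v = K.map t w

theorem exists_ratio_le : ∃ R, 0 < R ∧ R < 1 ∧ ∀ j, K.ratio j ≤ R := by
  obtain ⟨z, hz⟩ := K.carrier_nonempty
  obtain ⟨j, -⟩ := K.exists_map_eq hz
  have : Nonempty (Fin K.N) := ⟨j⟩
  obtain ⟨i, hi⟩ := Finite.exists_max K.ratio
  exact ⟨K.ratio i, K.ratio_pos i, K.ratio_lt_one i, hi⟩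

theorem exists_le_ratio : ∃ ρ, 0 < ρ ∧ ρ < 1 ∧ ∀ j, ρ ≤ K.ratio j := by
  obtain ⟨z, hz⟩ := K.carrier_nonempty
  obtain ⟨j, -⟩ := K.exists_map_eq hz
  have : Nonempty (Fin K.N) := ⟨j⟩
  obtain ⟨i, hi⟩ := Finite.exists_min K.ratio
  exact ⟨K.ratio i, K.ratio_pos i, K.ratio_lt_one i, hi⟩

/-- The coding map. -/
noncomputable def code (x : ℕ → Fin K.N) : Plane :=
  ∑' n, (∏ k ∈ Finset.range (n + 1), K.ratio (x k)) • K.shift (x n)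

theorem exists_shift_le : ∃ M, 0 ≤ M ∧ ∀ j, ‖K.shift j‖ ≤ M :=
  ⟨∑ j, ‖K.shift j‖, Finset.sum_nonneg fun _ _ => norm_nonneg _, fun j =>
    Finset.single_le_sum (f := fun j => ‖K.shift j‖) (fun _ _ => norm_nonneg _)
      (Finset.mem_univ j)⟩

theorem norm_code_term_le {R M : ℝ} (hR : ∀ j, K.ratio j ≤ R) (hR1 : R < 1)
    (hM : ∀ j, ‖K.shift j‖ ≤ M) (x : ℕ → Fin K.N) (n : ℕ) :
    ‖(∏ k ∈ Finset.range (n + 1), K.ratio (x k)) • K.shift (x n)‖ ≤ R ^ n * M := by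
  have h0 : 0 ≤ R := (K.ratio_pos (x 0)).le.trans (hR _)
  have hp : ∏ k ∈ Finset.range (n + 1), K.ratio (x k) ≤ R ^ (n + 1) := by
    have := Finset.prod_le_prod (s := Finset.range (n + 1)) (f := fun k => K.ratio (x k))
      (g := fun _ => R) (fun k _ => (K.ratio_pos (x k)).le) (fun k _ => hR (x k))
    simpa using this
  rw [norm_smul, Real.norm_of_nonneg (Finset.prod_nonneg fun k _ => (K.ratio_pos (x k)).le)]
  refine mul_le_mul (hp.trans ?_) (hM _) (norm_nonneg _) (pow_nonneg h0 _)
  exact pow_le_pow_of_le_one h0 hR1.le n.le_succ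

theorem summable_code (x : ℕ → Fin K.N) :
    Summable fun n => (∏ k ∈ Finset.range (n + 1), K.ratio (x k)) • K.shift (x n) := by
  obtain ⟨R, h0, h1, hR⟩ := K.exists_ratio_le
  obtain ⟨M, hM0, hM⟩ := K.exists_shift_le
  exact Summable.of_norm_bounded ((summable_geometric_of_lt_one h0.le h1).mul_right M)
    (K.norm_code_term_le hR h1 hM x)

theorem code_eq (x : ℕ → Fin K.N) : K.code x = K.map (x 0) (K.code (wtail x)) := by
  rw [code, (K.summable_code x).tsum_eq_zero_add, map, smul_add, code,
    ← (K.summable_code (wtail x)).tsum_const_smul, add_comm]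
  simp only [zero_add, Finset.range_one, Finset.prod_singleton, wtail_apply]
  congr 1
  refine tsum_congr fun n => ?_
  rw [Finset.prod_range_succ', smul_smul, mul_comm]

theorem exists_norm_code_le : ∃ B, ∀ x, ‖K.code x‖ ≤ B := by
  obtain ⟨R, h0, h1, hR⟩ := K.exists_ratio_le
  obtain ⟨M, hM0, hM⟩ := K.exists_shift_le
  exact ⟨_, fun x => tsum_of_norm_bounded
    ((summable_geometric_of_lt_one h0.le h1).mul_right M).hasSum (K.norm_code_term_le hR h1 hM x)⟩

/-- Removing `n` letters shows that the distance from the coded point to `K` is at most `R ^ n`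
times a uniform bound, for every `n`. -/
theorem code_mem (x : ℕ → Fin K.N) : K.code x ∈ K.carrier := by
  obtain ⟨R, h0, h1, hR⟩ := K.exists_ratio_le
  obtain ⟨B, hB⟩ := K.exists_norm_code_le
  obtain ⟨p, hp⟩ := K.carrier_nonempty
  have key : ∀ n : ℕ, ∀ x, Metric.infDist (K.code x) K.carrier ≤ R ^ n * (B + ‖p‖) := by
    intro n
    induction n with
    | zero =>
      intro x
      have := (Metric.infDist_le_dist_of_mem (x := K.code x) hp).trans (dist_le_norm_add_norm _ _)
      linarith [hB x]
    | succ n ih =>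
      intro x
      obtain ⟨q, hq, hqd⟩ := K.carrier_compact.exists_infDist_eq_dist ⟨p, hp⟩ (K.code (wtail x))
      have h2 := ih (wtail x)
      rw [hqd] at h2
      calc _ ≤ dist (K.code x) (K.map (x 0) q) :=
            Metric.infDist_le_dist_of_mem (K.map_mem_carrier _ hq)
        _ = K.ratio (x 0) * dist (K.code (wtail x)) q := by rw [K.code_eq, K.dist_map]
        _ ≤ R * (R ^ n * (B + ‖p‖)) := mul_le_mul (hR _) h2 dist_nonneg h0.le
        _ = _ := by ring
  rw [K.carrier_compact.isClosed.mem_iff_infDist_zero ⟨p, hp⟩]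
  exact eq_zero_of_forall_le_pow Metric.infDist_nonneg h0.le h1 fun n => key n x

theorem exists_code_eq {z : Plane} (hz : z ∈ K.carrier) : ∃ x, K.code x = z := by
  obtain ⟨R, h0, h1, hR⟩ := K.exists_ratio_le
  have hex : ∀ z : K.carrier, ∃ j, ∃ y : K.carrier, K.map j y = z := fun z => by
    obtain ⟨j, y, hy, h⟩ := K.exists_map_eq z.2
    exact ⟨j, ⟨y, hy⟩, h⟩
  choose j y hjy using hex
  let addr : K.carrier → ℕ → Fin K.N := fun z n => j (y^[n] z)
  have htail : ∀ z, wtail (addr z) = addr (y z) := fun z => by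
    funext n; simp [addr, wtail]
  have key : ∀ n : ℕ, ∀ z : K.carrier, dist (z : Plane) (K.code (addr z)) ≤
      R ^ n * Metric.diam K.carrier := by
    intro n
    induction n with
    | zero =>
      intro z
      simpa using Metric.dist_le_diam_of_mem K.carrier_compact.isBounded z.2 (K.code_mem _)
    | succ n ih =>
      intro z
      rw [K.code_eq, htail, ← hjy z]
      change dist (K.map (j z) _) (K.map (j z) _) ≤ _
      rw [K.dist_map, pow_succ', mul_assoc]
      exact mul_le_mul (hR _) (ih _) dist_nonneg h0.le
  refine ⟨addr ⟨z, hz⟩, ?_⟩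
  exact (dist_eq_zero.1 (eq_zero_of_forall_le_pow dist_nonneg h0.le h1 fun n => key n ⟨z, hz⟩)).symm

variable {K}

theorem dist_code_vertex_le {R : ℝ} (hR : ∀ j, K.ratio j ≤ R) {v : Plane}
    (hv : v ∈ triangleVertices) {a : Fin K.N} (ha : K.map a v = v) {n : ℕ} {x : ℕ → Fin K.N}
    (hx : run a n x) : dist (K.code x) v ≤ R ^ n := by
  induction n generalizing x with
  | zero =>
    rw [dist_eq_norm, pow_zero]
    exact norm_sub_le_one_of_mem_triangle (K.carrier_subset (K.code_mem x)) hv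
  | succ n ih =>
    obtain ⟨h0, h1⟩ := run_succ.1 hx
    rw [K.code_eq, h0]
    nth_rewrite 1 [← ha]
    rw [K.dist_map, pow_succ']
    exact mul_le_mul (hR _) (ih h1) dist_nonneg ((K.ratio_pos a).le.trans (hR a))

theorem dist_code_le_of_near {R : ℝ} (hR : ∀ j, K.ratio j ≤ R) {n : ℕ}
    {x y : ℕ → Fin K.N} (h : near K.Contact n x y) :
    dist (K.code x) (K.code y) ≤ 2 * R ^ n := by
  have hR0 : 0 ≤ R := (K.ratio_pos (x 0)).le.trans (hR _)
  induction n generalizing x y with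
  | zero =>
    have h2 : ∀ x, dist (K.code x) omegaAlpha ≤ 1 := fun x => by
      rw [dist_eq_norm]
      exact norm_sub_le_one_of_mem_triangle (K.carrier_subset (K.code_mem x)) omegaAlpha_mem
    have := dist_triangle_right (K.code x) (K.code y) omegaAlpha
    linarith [h2 x, h2 y]
  | succ n ih =>
    rcases h with ⟨h0, h1⟩ | ⟨a, b, ⟨-, v, hv, w, hw, ha, hb, hvw⟩, hxa, hyb⟩
    · rw [K.code_eq x, K.code_eq y, ← h0, K.dist_map]
      calc _ ≤ R * (2 * R ^ n) := mul_le_mul (hR _) (ih h1) dist_nonneg hR0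
        _ = _ := by ring
    · have h1 := dist_code_vertex_le hR hv ha hxa
      have h2 := dist_code_vertex_le hR hw hb hyb
      have h3 := dist_triangle (K.code x) (K.map (x 0) v) (K.code y)
      have h4 : dist (K.code x) (K.map (x 0) v) ≤ R * R ^ n := by
        rw [K.code_eq, K.dist_map]; exact mul_le_mul (hR _) h1 dist_nonneg hR0
      have h5 : dist (K.map (x 0) v) (K.code y) ≤ R * R ^ n := by
        rw [K.code_eq y, hvw, K.dist_map, dist_comm]
        exact mul_le_mul (hR _) h2 dist_nonneg hR0
      rw [pow_succ']; linarith

/-- The letters before the first one different from `a` only rescale about `v`. After them, the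
point lies in the image of `K` in a cell that does not fix `v`; this image misses `v` by
`eq_of_map_eq_vertex`, and by compactness there is a gap. -/
theorem exists_le_dist_code_vertex {ρ : ℝ} (hρ0 : 0 < ρ) (hρ1 : ρ ≤ 1)
    (hρ : ∀ j, ρ ≤ K.ratio j) :
    ∃ c > 0, ∀ v ∈ triangleVertices, ∀ a, K.map a v = v → ∀ n x, ¬ run a n x →
      c * ρ ^ n ≤ dist (K.code x) v := by
  have hc : ∃ c > 0, ∀ q : Fin K.N × triangleVertices, K.map q.1 q.2 ≠ q.2 →
      ∀ y ∈ K.carrier, c ≤ dist (K.map q.1 y) q.2 := by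
    have : Finite triangleVertices := by
      have : triangleVertices.Finite := by simp [triangleVertices]
      exact this
    refine exists_pos_forall (fun q a b hab h hq y hy => hab.trans (h hq y hy)) ?_
    rintro ⟨s, v, hv⟩
    obtain ⟨z, hz, hmin⟩ := K.carrier_compact.exists_isMinOn K.carrier_nonempty
      (f := fun y => dist (K.map s y) v)
      ((K.continuous_map s).dist continuous_const).continuousOn
    by_cases hq : K.map s v = v
    · exact ⟨1, one_pos, fun h => absurd hq h⟩
    refine ⟨dist (K.map s z) v, dist_pos.2 fun h => hq ?_, fun _ y hy => hmin hy⟩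
    have := eq_of_map_eq_vertex (K.carrier_subset hz) hv h
    exact this ▸ h
  obtain ⟨c, hc0, hc⟩ := hc
  refine ⟨c, hc0, fun v hv a ha n => ?_⟩
  induction n with
  | zero => exact fun x h => absurd (run_zero a x) h
  | succ n ih =>
    intro x hx
    rw [run_succ, not_and_or] at hx
    by_cases h0 : x 0 = a
    · have h1 := ih _ (hx.resolve_left (not_not.2 h0))
      rw [K.code_eq, h0]
      nth_rewrite 1 [← ha]
      rw [K.dist_map, pow_succ]
      nlinarith [hρ a, mul_pos hc0 (pow_pos hρ0 n), K.ratio_pos a,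
        dist_nonneg (x := K.code (wtail x)) (y := v)]
    · have h1 := hc ⟨x 0, v, hv⟩ (fun h => h0 (eq_of_map_vertex_eq hv (h.trans ha.symm))) _
        (K.code_mem (wtail x))
      rw [K.code_eq]
      have := pow_le_one₀ (n := n + 1) hρ0.le hρ1
      nlinarith

/-- Common first letters only rescale. At the first difference, either the two images of `K` are
disjoint and have a gap, or they touch in a vertex. In the second case one of the words leaves the
corner in time, hence is far from the vertex, and transversality makes it far from the other word.
-/
theorem exists_le_dist_code_of_not_near {ρ : ℝ} (hρ0 : 0 < ρ) (hρ1 : ρ ≤ 1)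
    (hρ : ∀ j, ρ ≤ K.ratio j) :
    ∃ c > 0, ∀ n x y, ¬ near K.Contact n x y → c * ρ ^ n ≤ dist (K.code x) (K.code y) := by
  obtain ⟨c₁, hc₁, h₁⟩ := exists_le_dist_code_vertex hρ0 hρ1 hρ
  have hc : ∃ c > 0, ∀ q : Fin K.N × Fin K.N,
      (∀ x ∈ K.carrier, ∀ y ∈ K.carrier, K.map q.1 x ≠ K.map q.2 y) →
      ∀ x ∈ K.carrier, ∀ y ∈ K.carrier, c ≤ dist (K.map q.1 x) (K.map q.2 y) := by
    refine exists_pos_forall (fun q a b hab h hq x hx y hy => hab.trans (h hq x hx y hy)) ?_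
    rintro ⟨s, t⟩
    obtain ⟨⟨z, w⟩, ⟨hz, hw⟩, hmin⟩ := (K.carrier_compact.prod K.carrier_compact).exists_isMinOn
      (K.carrier_nonempty.prod K.carrier_nonempty)
      (f := fun p : Plane × Plane => dist (K.map s p.1) (K.map t p.2))
      (((K.continuous_map s).comp continuous_fst).dist
        ((K.continuous_map t).comp continuous_snd)).continuousOn
    by_cases hq : K.map s z = K.map t w
    · exact ⟨1, one_pos, fun h => absurd hq (h z hz w hw)⟩
    refine ⟨dist (K.map s z) (K.map t w), dist_pos.2 hq, fun _ x hx y hy => ?_⟩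
    have h := hmin (Set.mk_mem_prod hx hy)
    simpa only [Set.mem_ofPred_eq] using h
  obtain ⟨c₂, hc₂, h₂⟩ := hc
  -- The half is the one lost in `dist_ge_of_touch`.
  set c := min (c₁ / 2) c₂
  have hc0 : 0 < c := lt_min (by linarith) hc₂
  have hcc₁ : c ≤ c₁ / 2 := min_le_left _ _
  have hcc₂ : c ≤ c₂ := min_le_right _ _
  refine ⟨c, hc0, fun n => ?_⟩
  induction n with
  | zero => exact fun x y h => absurd trivial h
  | succ n ih =>
    intro x y hxy
    have hp : 0 < ρ ^ n := pow_pos hρ0 n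
    by_cases h0 : x 0 = y 0
    · have h1 := ih (wtail x) (wtail y) fun h => hxy (Or.inl ⟨h0, h⟩)
      rw [K.code_eq x, K.code_eq y, ← h0, K.dist_map, pow_succ]
      nlinarith [hρ (x 0), mul_pos hc0 hp, K.ratio_pos (x 0)]
    by_cases hd : ∀ z ∈ K.carrier, ∀ w ∈ K.carrier, K.map (x 0) z ≠ K.map (y 0) w
    · have h1 := h₂ (x 0, y 0) hd _ (K.code_mem (wtail x)) _ (K.code_mem (wtail y))
      rw [K.code_eq x, K.code_eq y]
      have := pow_le_one₀ (n := n + 1) hρ0.le hρ1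
      simp only at h1
      nlinarith
    · push Not at hd
      obtain ⟨v, hvK, w, hwK, hvw⟩ := hd
      -- The common point comes from points of `K` that must be vertices of the triangle; as they
      -- lie in `K`, they have fixing symbols, which are the types of the contact.
      obtain ⟨⟨v', hv, hv'⟩, ⟨w', hw, hw'⟩⟩ := K.inter_subset _ _ h0
        ⟨⟨v, K.carrier_subset hvK, rfl⟩, ⟨w, K.carrier_subset hwK, hvw.symm⟩⟩
      obtain rfl : v' = v := K.map_injective _ hv'
      obtain rfl : w' = w := K.map_injective _ (hw'.trans hvw)
      obtain ⟨a, ha⟩ := exists_fixing hv hvK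
      obtain ⟨b, hb⟩ := exists_fixing hw hwK
      have hne : v' ≠ w' := by
        rintro rfl
        exact h0 (eq_of_map_vertex_eq hv hvw)
      have h1 := dist_ge_of_touch hv hw hne hvw (K.carrier_subset (K.code_mem (wtail x)))
        (K.carrier_subset (K.code_mem (wtail y)))
      rw [← K.code_eq, ← K.code_eq, K.code_eq x, K.code_eq y, K.dist_map, K.dist_map,
        ← K.code_eq, ← K.code_eq] at h1
      have hor : ¬ run a n (wtail x) ∨ ¬ run b n (wtail y) := by
        by_contra hcon
        push Not at hcon
        exact hxy (Or.inr ⟨a, b, ⟨h0, v', hv, w', hw, ha, hb, hvw⟩, hcon⟩)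
      have hd1 : 0 ≤ K.ratio (x 0) * dist (K.code (wtail x)) v' :=
        mul_nonneg (K.ratio_pos _).le dist_nonneg
      have hd2 : 0 ≤ K.ratio (y 0) * dist (K.code (wtail y)) w' :=
        mul_nonneg (K.ratio_pos _).le dist_nonneg
      have fin : ∀ (j : Fin K.N) (d : ℝ), c₁ * ρ ^ n ≤ d → c * ρ ^ (n + 1) ≤ K.ratio j * d / 2 := by
        intro j d hd
        have e1 : ρ * (c₁ * ρ ^ n) ≤ K.ratio j * d :=
          mul_le_mul (hρ j) hd (by positivity) (K.ratio_pos j).le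
        rw [pow_succ]
        nlinarith [mul_le_mul_of_nonneg_right hcc₁ (mul_pos hp hρ0).le]
      rcases hor with h | h
      · have := fin (x 0) _ (h₁ v' hv a ha n _ h); linarith
      · have := fin (y 0) _ (h₁ w' hw b hb n _ h); linarith

end FractalGasket

/-! ### Finite prefixes, coinduction for words, and transducers. -/

section Prefix

variable {S : Type*}

/-- Prepend a finite word to an infinite word. -/
def pre (l : List S) (x : ℕ → S) : ℕ → S := l.foldr wcons x

@[simp] theorem pre_nil (x : ℕ → S) : pre [] x = x := rfl
@[simp] theorem pre_cons (s : S) (l : List S) (x : ℕ → S) :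
    pre (s :: l) x = wcons s (pre l x) := rfl
@[simp] theorem pre_append (l l' : List S) (x : ℕ → S) : pre (l ++ l') x = pre l (pre l' x) := by
  simp [pre]

theorem pre_apply_of_lt (l : List S) (x : ℕ → S) (n : ℕ) (h : n < l.length) :
    pre l x n = l[n] := by
  induction l generalizing n with
  | nil => simp at h
  | cons s l ih =>
    cases n with
    | zero => rfl
    | succ n => simpa using ih n (by simpa using h)

theorem pre_apply_of_le (l : List S) (x : ℕ → S) (n : ℕ) (h : l.length ≤ n) :
    pre l x n = x (n - l.length) := by
  induction l generalizing n with
  | nil => rfl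
  | cons s l ih =>
    cases n with
    | zero => simp at h
    | succ n => simpa using ih n (by simpa using h)

/-- Prepend `m` times the letter `a`. -/
def rep (a : S) (m : ℕ) (x : ℕ → S) : ℕ → S := pre (List.replicate m a) x

@[simp] theorem rep_zero (a : S) (x : ℕ → S) : rep a 0 x = x := rfl
@[simp] theorem rep_succ (a : S) (m : ℕ) (x : ℕ → S) :
    rep a (m + 1) x = wcons a (rep a m x) := rfl

theorem rep_add (a : S) (m n : ℕ) (x : ℕ → S) : rep a (m + n) x = rep a m (rep a n x) := by
  induction m with
  | zero => simp
  | succ m ih => rw [Nat.succ_add, rep_succ, ih]; rfl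

theorem run_rep (a : S) {m n : ℕ} (x : ℕ → S) (h : n ≤ m) : run a n (rep a m x) := by
  induction n generalizing m with
  | zero => exact run_zero _ _
  | succ n ih =>
    cases m with
    | zero => omega
    | succ m => exact run_succ.2 ⟨rfl, ih (by omega)⟩

theorem le_of_run_rep {a : S} {m n : ℕ} {x : ℕ → S} (hx : x 0 ≠ a) (h : run a n (rep a m x)) :
    n ≤ m := by
  induction m generalizing n with
  | zero =>
    by_contra hn
    exact hx (h 0 (by omega))
  | succ m ih =>
    cases n with
    | zero => omega
    | succ n => have := ih (run_succ.1 h).2; omega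

theorem rep_inj {a : S} {m n : ℕ} {x y : ℕ → S} (hx : x 0 ≠ a) (hy : y 0 ≠ a)
    (h : rep a m x = rep a n y) : m = n ∧ x = y := by
  have h1 : m = n := le_antisymm (le_of_run_rep hy (h ▸ run_rep a x le_rfl))
    (le_of_run_rep hx (h ▸ run_rep a y le_rfl))
  subst h1
  refine ⟨rfl, ?_⟩
  clear hx hy
  induction m with
  | zero => exact h
  | succ m ih => exact ih (wcons_inj h).2

theorem exists_eq_rep {a : S} {m : ℕ} {x : ℕ → S} (h : run a m x) : ∃ y, x = rep a m y := by
  induction m generalizing x with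
  | zero => exact ⟨x, rfl⟩
  | succ m ih =>
    obtain ⟨h0, h1⟩ := run_succ.1 h
    obtain ⟨y, hy⟩ := ih h1
    exact ⟨y, by rw [rep_succ, ← hy, ← h0, wcons_wtail]⟩

/-- A word either is constant, or splits after its initial run. -/
theorem eq_rep_or_const (a : S) (x : ℕ → S) :
    (∃ m y, y 0 ≠ a ∧ x = rep a m y) ∨ x = fun _ => a := by
  classical
  by_cases h : ∃ k, x k ≠ a
  · obtain ⟨y, hy⟩ := exists_eq_rep (a := a) (m := Nat.find h) (x := x)
      fun k hk => not_not.1 (Nat.find_min h hk)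
    refine Or.inl ⟨_, y, ?_, hy⟩
    intro h0
    apply Nat.find_spec h
    have : ∀ k, rep a k y k = y 0 := fun k => by
      rw [rep, pre_apply_of_le _ _ _ (by simp)]
      simp
    exact (congrFun hy _).trans ((this _).trans h0)
  · push Not at h
    exact Or.inr (funext h)

theorem const_eq_wcons (a : S) : (fun _ : ℕ => a) = wcons a fun _ => a := by
  funext n; cases n <;> rfl

theorem const_eq_rep (a : S) (m : ℕ) : (fun _ : ℕ => a) = rep a m fun _ => a := by
  induction m with
  | zero => rfl
  | succ m ih => rw [rep_succ, ← ih, ← const_eq_wcons]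

theorem near_pre {C : S → S → S → S → Prop} {n : ℕ} {x y : ℕ → S} (l : List S)
    (h : near C n x y) : near C (n + l.length) (pre l x) (pre l y) := by
  induction l with
  | nil => exact h
  | cons s l ih => exact Or.inl ⟨rfl, ih⟩

theorem near_of_run {C : S → S → S → S → Prop} {n : ℕ} {a : S} {x y : ℕ → S}
    (hx : run a n x) (hy : run a n y) : near C n x y := by
  obtain ⟨x', rfl⟩ := exists_eq_rep hx
  obtain ⟨y', rfl⟩ := exists_eq_rep hy
  have := near_pre (C := C) (n := 0) (x := x') (y := y') (List.replicate n a) trivial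
  rw [List.length_replicate, zero_add] at this
  exact this

/-- Coinduction for `near`. -/
theorem near_of_bisim {C : S → S → S → S → Prop} (R : (ℕ → S) → (ℕ → S) → Prop)
    (h : ∀ x y, R x y → (∀ n, near C n x y) ∨
      ∃ l ≠ [], ∃ x' y', x = pre l x' ∧ y = pre l y' ∧ R x' y') (n : ℕ) (x y : ℕ → S)
    (hR : R x y) : near C n x y := by
  induction n using Nat.strong_induction_on generalizing x y with
  | _ n ih =>
    rcases h x y hR with h1 | ⟨l, hl, x', y', rfl, rfl, hR'⟩
    · exact h1 n
    · have hlen : 0 < l.length := List.length_pos_of_ne_nil hl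
      rcases Nat.eq_zero_or_pos n with rfl | hn
      · trivial
      · exact (near_pre l (ih (n - l.length) (by omega) x' y' hR')).anti (by omega)

/-- With no contacts at all, `near` says that prefixes agree; this turns `near_of_bisim` into a
coinduction principle for equality of words. -/
theorem eq_of_near_false {x y : ℕ → S} (h : ∀ n, near (fun _ _ _ _ => False) n x y) : x = y := by
  funext k
  have := h (k + 1)
  clear h
  induction k generalizing x y with
  | zero =>
    rcases this with h | ⟨_, _, h, -⟩
    · exact h.1
    · exact h.elim
  | succ k ih =>
    rcases this with h | ⟨_, _, h, -⟩
    · exact ih h.2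
    · exact h.elim

/-- The infinite word that is obtained by iterating the step `p`, which emits a finite word and
passes to a new infinite word. -/
def transduce (p : (ℕ → S) → List S × (ℕ → S)) (hp : ∀ x, (p x).1 ≠ []) (x : ℕ → S) (n : ℕ) : S :=
  if h : n < (p x).1.length then (p x).1[n]
  else
    have : n - (p x).1.length < n := by
      have := List.length_pos_of_ne_nil (hp x)
      omega
    transduce p hp (p x).2 (n - (p x).1.length)
termination_by n

theorem transduce_eq (p : (ℕ → S) → List S × (ℕ → S)) (hp : ∀ x, (p x).1 ≠ []) (x : ℕ → S) :
    transduce p hp x = pre (p x).1 (transduce p hp (p x).2) := by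
  funext n
  rw [transduce]
  split_ifs with h
  · rw [pre_apply_of_lt _ _ _ h]
  · rw [pre_apply_of_le _ _ _ (by omega)]

theorem exists_transducer {P : (ℕ → S) → List S → (ℕ → S) → Prop}
    (h : ∀ x, ∃ l ≠ [], ∃ y, P x l y) :
    ∃ f : (ℕ → S) → ℕ → S, ∀ x, ∃ l y, P x l y ∧ f x = pre l (f y) := by
  choose l hl y hP using h
  exact ⟨transduce (fun x => (l x, y x)) hl, fun x => ⟨l x, y x, hP x,
    transduce_eq (fun x => (l x, y x)) hl x⟩⟩

end Prefix

/-! ### Combinatorics of hanging cells, and maps that substitute prefixes. -/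

/-- The combinatorics of the touching cells of a gasket with isolated top: `C s a t b` says that the
cells `s` and `t` touch in the corner of type `a` of the first, and `b` of the second; `top` is
the top corner; the `hung` symbols are those whose top touches another cell, for example the one
of `base i` in its corner `side i`; and `free` is the symbol of a cell that is not hung and not at a
corner. -/
structure HangingData (S : Type*) where
  C : S → S → S → S → Prop
  top : S
  free : S
  hung : Set S
  base : S → S
  side : S → S
  symm : ∀ s a t b, C s a t b → C t b s a
  trans : ∀ s a t b u c, C s a t b → C t b u c → (s = u ∧ a = c) ∨ C s a u c
  type_ne : ∀ s a t b, C s a t b → a ≠ b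
  not_self : ∀ a t b, ¬ C a a t b
  not_top : ∀ a t b, ¬ C top a t b
  contact_base : ∀ i ∈ hung, C i top (base i) (side i)
  mem_hung : ∀ i t b, C i top t b → i ∈ hung
  base_not_corner : ∀ i ∈ hung, ∀ s t b, ¬ C s (base i) t b
  free_not_corner : ∀ s t b, ¬ C s free t b
  free_not_hung : free ∉ hung

namespace HangingData

variable {S : Type*} (d : HangingData S)

/-- The contacts in corners that satisfy `P`. -/
def rel (P : S → Prop) (s a t b : S) : Prop := d.C s a t b ∧ P a ∧ P b

theorem rel_symm (P : S → Prop) (s a t b : S) (h : d.rel P s a t b) : d.rel P t b s a :=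
  ⟨d.symm _ _ _ _ h.1, h.2.2, h.2.1⟩

/-- The corners `a` of `s` and `b` of `t` are the same point. -/
def same (s a t b : S) : Prop := (s = t ∧ a = b) ∨ d.C s a t b

variable {d}

theorem same.symm {s a t b : S} (h : d.same s a t b) : d.same t b s a := by
  rcases h with ⟨rfl, rfl⟩ | h
  · exact Or.inl ⟨rfl, rfl⟩
  · exact Or.inr (d.symm _ _ _ _ h)

theorem same.trans {s a t b u c : S} (h : d.same s a t b) (h' : d.same t b u c) :
    d.same s a u c := by
  rcases h with ⟨rfl, rfl⟩ | h
  · exact h'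
  · rcases h' with ⟨rfl, rfl⟩ | h'
    · exact Or.inr h
    · exact d.trans _ _ _ _ _ _ h h'

theorem near_of_same {P : S → Prop} {s a t b : S} (h : d.same s a t b) (ha : P a) (hb : P b)
    {n : ℕ} {x y : ℕ → S} (hx0 : x 0 = s) (hx : run a n (wtail x)) (hy0 : y 0 = t)
    (hy : run b n (wtail y)) : near (d.rel P) (n + 1) x y := by
  subst hx0 hy0
  rcases h with ⟨h, rfl⟩ | h
  · exact Or.inl ⟨h, near_of_run hx hy⟩
  · exact Or.inr ⟨a, b, ⟨h, ha, hb⟩, hx, hy⟩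

section Symbols

variable {i j : S}

theorem side_ne_top (hi : i ∈ d.hung) : d.side i ≠ d.top :=
  (d.type_ne _ _ _ _ (d.contact_base i hi)).symm

theorem base_ne_top (hi : i ∈ d.hung) : d.base i ≠ d.top := fun h =>
  d.not_top _ _ _ (h ▸ d.symm _ _ _ _ (d.contact_base i hi))

theorem top_not_hung : d.top ∉ d.hung := fun h => d.not_top _ _ _ (d.contact_base _ h)

theorem base_ne_side (hi : i ∈ d.hung) (hj : j ∈ d.hung) : d.side i ≠ d.base j := fun h =>
  d.base_not_corner j hj _ _ _ (h ▸ d.symm _ _ _ _ (d.contact_base i hi))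

theorem free_ne_side (hi : i ∈ d.hung) : d.free ≠ d.side i := fun h =>
  d.free_not_corner _ _ _ (h ▸ d.symm _ _ _ _ (d.contact_base i hi))

theorem free_ne_top (hi : i ∈ d.hung) : d.free ≠ d.top := fun h =>
  d.free_not_corner _ _ _ (h ▸ d.contact_base i hi)

theorem base_inj (hi : i ∈ d.hung) (hj : j ∈ d.hung) (h : d.base i = d.base j)
    (h' : d.side i = d.side j) : i = j := by
  have h1 := d.contact_base i hi
  rw [h, h'] at h1
  rcases d.trans _ _ _ _ _ _ h1 (d.symm _ _ _ _ (d.contact_base j hj)) with h2 | h2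
  · exact h2.1
  · exact absurd rfl (d.type_ne _ _ _ _ h2)

end Symbols

variable (d)

/-- The word `base · side ^ m · free · top` as a list. -/
def towerList (i : S) (m : ℕ) : List S :=
  d.base i :: (List.replicate m (d.side i) ++ [d.free, d.top])

/-- The prefix `base · side ^ m · free · top`. -/
def tower (i : S) (m : ℕ) (x : ℕ → S) : ℕ → S :=
  wcons (d.base i) (rep (d.side i) m (wcons d.free (wcons d.top x)))

/-- The word `i · top ^ m` as a list. -/
def tipList (i : S) (m : ℕ) : List S := i :: List.replicate m d.top

/-- The prefix `i · top ^ m`. -/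
def tip (i : S) (m : ℕ) (x : ℕ → S) : ℕ → S := wcons i (rep d.top m x)

theorem pre_towerList (i : S) (m : ℕ) (x : ℕ → S) : pre (d.towerList i m) x = d.tower i m x := by
  simp [towerList, tower, rep]

theorem pre_tipList (i : S) (m : ℕ) (x : ℕ → S) : pre (d.tipList i m) x = d.tip i m x := rfl

theorem length_towerList (i : S) (m : ℕ) : (d.towerList i m).length = m + 3 := by
  simp [towerList]

theorem length_tipList (i : S) (m : ℕ) : (d.tipList i m).length = m + 1 := by
  simp [tipList]

/-- The prefix can be read off: the first two letters determine `i`, since only one cell hangs at a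
given corner, and the run of `side i` ends visibly at `free`. The bounds on `m` and `n` make the
second letter a `side`. -/
theorem tower_inj {i j : S} (hi : i ∈ d.hung) (hj : j ∈ d.hung) {m n : ℕ} (hm : 1 ≤ m) (hn : 1 ≤ n)
    {x y : ℕ → S} (h : d.tower i m x = d.tower j n y) : i = j ∧ m = n ∧ x = y := by
  obtain ⟨hb, h⟩ := wcons_inj h
  have hs : d.side i = d.side j := by
    have := congrFun h 0
    obtain ⟨m, rfl⟩ := Nat.exists_eq_add_of_le' hm
    obtain ⟨n, rfl⟩ := Nat.exists_eq_add_of_le' hn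
    simpa using this
  obtain rfl := base_inj hi hj hb hs
  obtain ⟨rfl, h'⟩ := rep_inj (x := wcons d.free (wcons d.top x)) (y := wcons d.free (wcons d.top y))
    (free_ne_side hi) (free_ne_side hi) h
  exact ⟨rfl, rfl, (wcons_inj (wcons_inj h').2).2⟩

theorem tower_ne_tip {i j : S} (hi : i ∈ d.hung) {m n : ℕ} (hm : 1 ≤ m) (hn : 1 ≤ n)
    {x y : ℕ → S} : d.tower i m x ≠ d.tip j n y := fun h => by
  have := congrFun h 1
  obtain ⟨m, rfl⟩ := Nat.exists_eq_add_of_le' hm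
  obtain ⟨n, rfl⟩ := Nat.exists_eq_add_of_le' hn
  exact side_ne_top hi this

/-- The words at whose beginning a substitution takes place. -/
def Pat (x : ℕ → S) : Prop :=
  (∃ i ∈ d.hung, ∃ m ≥ 1, ∃ y, x = d.tower i m y) ∨ ∃ i ∈ d.hung, ∃ y, x = d.tip i 3 y

/-- The first two letters are as in a word with `Pat`. -/
def Head (x : ℕ → S) : Prop :=
  (∃ i ∈ d.hung, x 0 = d.base i ∧ x 1 = d.side i) ∨ ∃ i ∈ d.hung, x 0 = i ∧ x 1 = d.top

variable {d}

theorem head_tower {i : S} (hi : i ∈ d.hung) {m : ℕ} (hm : 1 ≤ m) (x : ℕ → S) :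
    d.Head (d.tower i m x) := by
  obtain ⟨m, rfl⟩ := Nat.exists_eq_add_of_le' hm
  exact Or.inl ⟨i, hi, rfl, rfl⟩

theorem head_tip {i : S} (hi : i ∈ d.hung) {m : ℕ} (hm : 1 ≤ m) (x : ℕ → S) :
    d.Head (d.tip i m x) := by
  obtain ⟨m, rfl⟩ := Nat.exists_eq_add_of_le' hm
  exact Or.inr ⟨i, hi, rfl, rfl⟩

theorem Pat.head {x : ℕ → S} (h : d.Pat x) : d.Head x := by
  rcases h with ⟨i, hi, m, hm, y, rfl⟩ | ⟨i, hi, y, rfl⟩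
  · exact head_tower hi hm y
  · exact head_tip hi (by norm_num) y

theorem not_head_wcons_side {i : S} (hi : i ∈ d.hung) {x : ℕ → S} (hx : x 0 ≠ d.top) :
    ¬ d.Head (wcons (d.side i) x) := by
  rintro (⟨j, hj, h, -⟩ | ⟨j, hj, -, h⟩)
  · exact base_ne_side hi hj h
  · exact hx h

theorem not_head_wcons_free (x : ℕ → S) :
    ¬ d.Head (wcons d.free (wcons d.top x)) := by
  rintro (⟨j, hj, -, h⟩ | ⟨j, hj, h, -⟩)
  · exact side_ne_top hj h.symm
  · exact d.free_not_hung ((show d.free = j from h) ▸ hj)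

theorem not_head_wcons_top (x : ℕ → S) : ¬ d.Head (wcons d.top x) := by
  rintro (⟨j, hj, h, -⟩ | ⟨j, hj, h, -⟩)
  · exact base_ne_top hj h.symm
  · exact d.top_not_hung ((show d.top = j from h) ▸ hj)

/-- A map of words that acts letter by letter as long as there is no substitution. -/
structure Coder (d : HangingData S) (f : (ℕ → S) → ℕ → S) : Prop where
  single : ∀ x, ¬ d.Pat x → f x = wcons (x 0) (f (wtail x))
  head : ∀ x, d.Pat x → d.Head (f x)

namespace Coder

variable {f : (ℕ → S) → ℕ → S} (hf : Coder d f)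
include hf

/-- A pattern is always replaced by a word with `Head`, so a letter of the output that does not
start a `Head` was copied from the input. This is how outputs are decoded. -/
theorem inv {x Y : ℕ → S} {c : S} (h : f x = wcons c Y) (hY : ¬ d.Head (wcons c Y)) :
    ∃ y, x = wcons c y ∧ f y = Y := by
  have hP : ¬ d.Pat x := fun hx => hY (h ▸ hf.head x hx)
  rw [hf.single x hP] at h
  obtain ⟨h0, h1⟩ := wcons_inj h
  exact ⟨wtail x, by rw [← h0, wcons_wtail], h1⟩

theorem inv_rep_top {m : ℕ} {x Y : ℕ → S} (h : f x = rep d.top m Y) :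
    ∃ y, x = rep d.top m y ∧ f y = Y := by
  induction m generalizing x with
  | zero => exact ⟨x, rfl, h⟩
  | succ m ih =>
    obtain ⟨y, rfl, hy⟩ := hf.inv h (not_head_wcons_top _)
    obtain ⟨z, rfl, hz⟩ := ih hy
    exact ⟨z, rfl, hz⟩

theorem inv_rep_side {i : S} (hi : i ∈ d.hung) {m : ℕ} {x Y : ℕ → S}
    (h : f x = rep (d.side i) m (wcons d.free (wcons d.top Y))) :
    ∃ y, x = rep (d.side i) m (wcons d.free (wcons d.top y)) ∧ f y = Y := by
  induction m generalizing x with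
  | zero =>
    obtain ⟨y, rfl, hy⟩ := hf.inv h (not_head_wcons_free _)
    obtain ⟨z, rfl, hz⟩ := hf.inv hy (not_head_wcons_top _)
    exact ⟨z, rfl, hz⟩
  | succ m ih =>
    obtain ⟨y, rfl, hy⟩ := hf.inv h (not_head_wcons_side hi (by
      cases m with
      | zero => exact free_ne_top hi
      | succ m => exact side_ne_top hi))
    obtain ⟨z, rfl, hz⟩ := ih hy
    exact ⟨z, rfl, hz⟩

/-- A pattern in the output after a copied first letter would decode letter by letter, by
`inv_rep_side` or `inv_rep_top`, into a pattern in the input. This lets the two substitutions cancel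
where neither acts. -/
theorem not_pat {x : ℕ → S} (hx : ¬ d.Pat x) : ¬ d.Pat (f x) := by
  rw [hf.single x hx]
  rintro (⟨i, hi, m, hm, y, h⟩ | ⟨i, hi, y, h⟩)
  · obtain ⟨h0, h1⟩ := wcons_inj h
    obtain ⟨z, hz, -⟩ := hf.inv_rep_side hi h1
    exact hx (Or.inl ⟨i, hi, m, hm, z, by rw [tower, ← hz, ← h0, wcons_wtail]⟩)
  · obtain ⟨h0, h1⟩ := wcons_inj h
    obtain ⟨z, hz, -⟩ := hf.inv_rep_top h1
    exact hx (Or.inr ⟨i, hi, z, by rw [tip, ← hz, ← h0, wcons_wtail]⟩)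

theorem apply_zero_ne_top {x : ℕ → S} (hx : x 0 ≠ d.top) : f x 0 ≠ d.top := fun h => by
  obtain ⟨y, rfl, -⟩ := hf.inv (x := x) (c := d.top) (Y := wtail (f x))
    (by rw [← h, wcons_wtail]) (not_head_wcons_top _)
  exact hx rfl

/-- A run of a corner symbol `a` other than `top` contains no pattern: `a` is not a `base`, and a
tip would need `top` as its second letter. The second letter must be known too, hence the loss of
one. -/
theorem run_apply {a s t b : S} (ha : d.C s a t b) (hat : a ≠ d.top) {k : ℕ} {x : ℕ → S}
    (hx : run a (k + 1) x) : run a k (f x) := by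
  induction k generalizing x with
  | zero => exact run_zero _ _
  | succ k ih =>
    obtain ⟨h0, h1⟩ := run_succ.1 hx
    have hP : ¬ d.Pat x := fun h => by
      rcases h.head with ⟨j, hj, h, -⟩ | ⟨j, hj, -, h⟩
      · exact d.base_not_corner j hj _ _ _ (h ▸ h0 ▸ ha)
      · exact hat ((h1 0 k.succ_pos).symm.trans h)
    rw [hf.single x hP]
    exact run_succ.2 ⟨h0, ih h1⟩

/-- If the initial runs of words keep their place up to an error of three letters, and
substitutions respect `near`, then so does `f`. -/
theorem near_apply {P Q : S → Prop}
    (shadow : ∀ x a t b k, d.C (x 0) a t b → P a → run a (k + 3) (wtail x) →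
      ∃ s c, d.same s c (x 0) a ∧ Q c ∧ f x 0 = s ∧ run c k (wtail (f x)))
    (step : ∀ x, d.Pat x → ∀ y, x 0 = y 0 → ∀ n, 7 ≤ n → near (d.rel P) n (wtail x) (wtail y) →
      (∃ l ≠ [], ∃ x' y', l.length ≤ n + 1 ∧ f x = pre l (f x') ∧ f y = pre l (f y') ∧
        near (d.rel P) (n + 1 - l.length) x' y') ∨
      ∃ a t b, d.C (x 0) a t b ∧ P a ∧ run a (n - 3) (wtail x) ∧ run a (n - 3) (wtail y))
    {n : ℕ} {x y : ℕ → S} (h : near (d.rel P) n x y) : near (d.rel Q) (n - 7) (f x) (f y) := by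
  induction n using Nat.strong_induction_on generalizing x y with
  | _ n ih =>
    rcases Nat.lt_or_ge 7 n with hn | hn
    swap
    · rw [Nat.sub_eq_zero_of_le hn]; trivial
    obtain ⟨n, rfl⟩ : ∃ m, n = m + 1 := ⟨n - 1, by omega⟩
    -- Both words are close to corners that are the same point, so both images are close to corners
    -- that are the same point. Three letters are given up on entry and three more by `shadow`,
    -- which `7` covers.
    have close : ∀ {a b t' b' t'' b''}, d.C (x 0) a t' b' → d.C (y 0) b t'' b'' → P a → P b →
        d.same (x 0) a (y 0) b → run a (n - 3) (wtail x) → run b (n - 3) (wtail y) →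
        near (d.rel Q) (n + 1 - 7) (f x) (f y) := by
      intro a b t' b' t'' b'' hC hC' ha hb hs hxa hyb
      obtain ⟨s, c, h1, h2, h3, h4⟩ := shadow x a _ _ (n - 6) hC ha (hxa.mono (by omega))
      obtain ⟨s', c', h1', h2', h3', h4'⟩ := shadow y b _ _ (n - 6) hC' hb (hyb.mono (by omega))
      exact (near_of_same ((h1.trans hs).trans h1'.symm) h2 h2' h3 h4 h3' h4').anti (by omega)
    rcases h with ⟨h0, h1⟩ | ⟨a, b, ⟨hC, ha, hb⟩, hxa, hyb⟩
    swap
    · exact close hC (d.symm _ _ _ _ hC) ha hb (Or.inr hC) (hxa.mono (by omega))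
        (hyb.mono (by omega))
    by_cases hx : d.Pat x
    · rcases step x hx y h0 n (by omega) h1 with ⟨l, hl, x', y', hln, hfx, hfy, hn'⟩ |
        ⟨a, t, b, hC, ha, hxa, hya⟩
      · have hlen : 0 < l.length := List.length_pos_of_ne_nil hl
        rw [hfx, hfy]
        exact (near_pre l (ih _ (by omega) hn')).anti (by omega)
      · exact close hC (h0 ▸ hC) ha ha (Or.inl ⟨h0, rfl⟩) hxa hya
    by_cases hy : d.Pat y
    · rcases step y hy x h0.symm n (by omega) (h1.symm (d.rel_symm P)) with
        ⟨l, hl, x', y', hln, hfx, hfy, hn'⟩ | ⟨a, t, b, hC, ha, hxa, hya⟩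
      · have hlen : 0 < l.length := List.length_pos_of_ne_nil hl
        rw [hfx, hfy]
        exact (near_pre l (ih _ (by omega) (hn'.symm (d.rel_symm P)))).anti (by omega)
      · exact close (h0 ▸ hC) hC ha ha (Or.inl ⟨h0, rfl⟩) hya hxa
    rw [hf.single x hx, hf.single y hy, ← h0]
    have h2 := near_pre [x 0] (ih n (by omega) h1)
    exact h2.anti (by simp; omega)

end Coder

section Rigid

variable {P : S → Prop}

/-- The pieces `side ^ k · free · top` are isolated. A contact along the run would have to be in the
corner named by the next letter: for `side` this contradicts `not_self`, for `free` it is no corner,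
and after `free` it would make `free` hung. The top cell itself touches nothing. The second
alternative is that level `n` is too coarse to see the end of the run. -/
theorem near_rep_side {i : S} {k n : ℕ} {X y : ℕ → S}
    (h : near (d.rel P) n (rep (d.side i) k (wcons d.free (wcons d.top X))) y) :
    (k + 3 ≤ n ∧ ∃ z, y = rep (d.side i) k (wcons d.free (wcons d.top z)) ∧
      near (d.rel P) (n - k - 2) X z) ∨
    (n < k + 3 ∧ run (d.side i) (n - 3) y) := by
  rcases Nat.lt_or_ge n 3 with hn | hn
  · exact Or.inr ⟨by omega, by rw [Nat.sub_eq_zero_of_le hn.le]; exact run_zero _ _⟩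
  induction k generalizing n y with
  | zero =>
    left
    obtain ⟨n, rfl⟩ : ∃ m, n = m + 2 := ⟨n - 2, by omega⟩
    rcases h with ⟨h0, h⟩ | ⟨a, b, ⟨hC, -⟩, ha, -⟩
    · rcases h with ⟨h0', h⟩ | ⟨a, b, ⟨hC, -⟩, ha, -⟩
      · refine ⟨by omega, wtail (wtail y), ?_, h⟩
        rw [← wcons_wtail y, ← h0, ← wcons_wtail (wtail y), ← h0']; rfl
      · exact (d.not_top _ _ _ hC).elim
    · have : d.top = a := ha 0 (Nat.succ_pos _)
      subst this
      exact (d.free_not_hung (d.mem_hung _ _ _ hC)).elim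
  | succ k ih =>
    obtain ⟨n, rfl⟩ : ∃ m, n = m + 1 := ⟨n - 1, by omega⟩
    rcases h with ⟨h0, h⟩ | ⟨a, b, ⟨hC, -⟩, ha, -⟩
    · have hy : y = wcons (d.side i) (wtail y) := by rw [← wcons_wtail y, ← h0]; rfl
      rcases Nat.lt_or_ge n 3 with hn' | hn'
      swap
      · rcases ih h hn' with ⟨h1, z, hz, hz'⟩ | ⟨h1, h2⟩
        · refine Or.inl ⟨by omega, z, ?_, ?_⟩
          · rw [hy, hz]; rfl
          · rwa [show n + 1 - (k + 1) - 2 = n - k - 2 by omega]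
        · refine Or.inr ⟨by omega, ?_⟩
          rw [show n + 1 - 3 = (n - 3) + 1 by omega]
          exact run_succ.2 ⟨h0.symm, h2⟩
      · refine Or.inr ⟨by omega, ?_⟩
        rw [show n + 1 - 3 = 0 by omega]
        exact run_zero _ _
    · exfalso
      have h0 := ha 0 (by omega)
      cases k with
      | zero => exact d.free_not_corner _ _ _ (by rw [show d.free = a from h0]; exact hC)
      | succ k => exact d.not_self _ _ _ ((show d.side i = a from h0) ▸ hC)

theorem near_rep_top {k n : ℕ} {X y : ℕ → S} (h : near (d.rel P) n (rep d.top k X) y) :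
    (k ≤ n ∧ ∃ z, y = rep d.top k z ∧ near (d.rel P) (n - k) X z) ∨
    (n < k ∧ run d.top n y) := by
  induction k generalizing n y with
  | zero => exact Or.inl ⟨n.zero_le, y, rfl, h⟩
  | succ k ih =>
    rcases n with _ | n
    · exact Or.inr ⟨k.succ_pos, run_zero _ _⟩
    rcases h with ⟨h0, h⟩ | ⟨a, b, ⟨hC, -⟩, -⟩
    · rcases ih h with ⟨h1, z, hz, hz'⟩ | ⟨h1, h2⟩
      · refine Or.inl ⟨by omega, z, ?_, ?_⟩
        · rw [← wcons_wtail y, ← h0, hz]; rfl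
        · rwa [Nat.succ_sub_succ]
      · exact Or.inr ⟨by omega, run_succ.2 ⟨h0.symm, h2⟩⟩
    · exact (d.not_top _ _ _ hC).elim

theorem near_zero_eq_top {n : ℕ} (hn : 1 ≤ n) {x y : ℕ → S} (h : near (d.rel P) n x y) :
    x 0 = d.top ↔ y 0 = d.top := by
  obtain ⟨n, rfl⟩ := Nat.exists_eq_add_of_le' hn
  rcases h with ⟨h0, -⟩ | ⟨a, b, ⟨hC, -⟩, -⟩
  · rw [h0]
  · constructor
    · intro h; exact (d.not_top _ _ _ (h ▸ hC)).elim
    · intro h; exact (d.not_top _ _ _ (h ▸ d.symm _ _ _ _ hC)).elim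

end Rigid

end HangingData

/-! ### The two mutually inverse substitutions that detach hanging cells. -/

namespace HangingData

variable {S : Type*} {d : HangingData S}

/-- The hotel map of the overview. Each rule is realised by a transducer that reads and writes
prefixes of equal length, namely `m + 4`, `m + 3` and `4`; the rules do not overlap by `tower_inj`
and `tower_ne_tip`. -/
theorem exists_unfold (d : HangingData S) : ∃ f : (ℕ → S) → ℕ → S,
    (∀ x, ¬ d.Pat x → f x = wcons (x 0) (f (wtail x))) ∧
    (∀ i ∈ d.hung, ∀ m ≥ 1, ∀ x,
      f (d.tower i m (wcons d.top x)) = d.tower i (m + 1) (f x)) ∧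
    (∀ i ∈ d.hung, ∀ m ≥ 1, ∀ x, x 0 ≠ d.top → f (d.tower i m x) = d.tip i (m + 2) (f x)) ∧
    ∀ i ∈ d.hung, ∀ x, f (d.tip i 3 x) = d.tower i 1 (f x) := by
  obtain ⟨f, hf⟩ := exists_transducer (P := fun x l y =>
    (¬ d.Pat x → l = [x 0] ∧ y = wtail x) ∧
    (∀ i ∈ d.hung, ∀ m ≥ 1, ∀ z, x = d.tower i m (wcons d.top z) →
      l = d.towerList i (m + 1) ∧ y = z) ∧
    (∀ i ∈ d.hung, ∀ m ≥ 1, ∀ z, z 0 ≠ d.top → x = d.tower i m z →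
      l = d.tipList i (m + 2) ∧ y = z) ∧
    ∀ i ∈ d.hung, ∀ z, x = d.tip i 3 z → l = d.towerList i 1 ∧ y = z) (fun x => by
      by_cases hx : d.Pat x
      · rcases hx with ⟨i, hi, m, hm, y, rfl⟩ | ⟨i, hi, y, rfl⟩
        · by_cases hy : y 0 = d.top
          · refine ⟨d.towerList i (m + 1), by simp [towerList], wtail y,
              fun h => absurd (Or.inl ⟨i, hi, m, hm, y, rfl⟩) h, ?_, ?_, ?_⟩
            · intro j hj k hk z h
              obtain ⟨rfl, rfl, rfl⟩ := d.tower_inj hi hj hm hk h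
              exact ⟨rfl, rfl⟩
            · intro j hj k hk z hz h
              obtain ⟨rfl, rfl, rfl⟩ := d.tower_inj hi hj hm hk h
              exact absurd hy hz
            · exact fun j hj z h => absurd h (d.tower_ne_tip hi hm (by norm_num))
          · refine ⟨d.tipList i (m + 2), by simp [tipList], y,
              fun h => absurd (Or.inl ⟨i, hi, m, hm, y, rfl⟩) h, ?_, ?_, ?_⟩
            · intro j hj k hk z h
              obtain ⟨rfl, rfl, rfl⟩ := d.tower_inj hi hj hm hk h
              exact absurd rfl hy
            · intro j hj k hk z hz h
              obtain ⟨rfl, rfl, rfl⟩ := d.tower_inj hi hj hm hk h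
              exact ⟨rfl, rfl⟩
            · exact fun j hj z h => absurd h (d.tower_ne_tip hi hm (by norm_num))
        · refine ⟨d.towerList i 1, by simp [towerList], y,
            fun h => absurd (Or.inr ⟨i, hi, y, rfl⟩) h, ?_, ?_, ?_⟩
          · exact fun j hj k hk z h => absurd h.symm (d.tower_ne_tip hj hk (by norm_num))
          · exact fun j hj k hk z _ h => absurd h.symm (d.tower_ne_tip hj hk (by norm_num))
          · intro j hj z h
            obtain ⟨rfl, h'⟩ := wcons_inj h
            exact ⟨rfl, (wcons_inj (wcons_inj (wcons_inj h').2).2).2⟩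
      · refine ⟨[x 0], by simp, wtail x, fun _ => ⟨rfl, rfl⟩, ?_, ?_, ?_⟩
        · exact fun i hi m hm z h => absurd (Or.inl ⟨i, hi, m, hm, _, h⟩) hx
        · exact fun i hi m hm z _ h => absurd (Or.inl ⟨i, hi, m, hm, _, h⟩) hx
        · exact fun i hi z h => absurd (Or.inr ⟨i, hi, _, h⟩) hx)
  refine ⟨f, ?_, ?_, ?_, ?_⟩
  · intro x hx
    obtain ⟨l, y, ⟨h, -⟩, he⟩ := hf x
    obtain ⟨rfl, rfl⟩ := h hx
    exact he
  · intro i hi m hm x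
    obtain ⟨l, y, ⟨-, h, -⟩, he⟩ := hf (d.tower i m (wcons d.top x))
    obtain ⟨rfl, rfl⟩ := h i hi m hm x rfl
    rw [he, pre_towerList]
  · intro i hi m hm x hx
    obtain ⟨l, y, ⟨-, -, h, -⟩, he⟩ := hf (d.tower i m x)
    obtain ⟨rfl, rfl⟩ := h i hi m hm x hx rfl
    rw [he, pre_tipList]
  · intro i hi x
    obtain ⟨l, y, ⟨-, -, -, h⟩, he⟩ := hf (d.tip i 3 x)
    obtain ⟨rfl, rfl⟩ := h i hi x rfl
    rw [he, pre_towerList]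

theorem tip_add_two (i : S) (m : ℕ) (hm : 1 ≤ m) (x : ℕ → S) :
    d.tip i (m + 2) x = d.tip i 3 (rep d.top (m - 1) x) := by
  rw [tip, tip, ← rep_add, show m + 2 = 3 + (m - 1) by omega]

theorem tip_inj {i j : S} {m n : ℕ} {x y : ℕ → S} (hx : x 0 ≠ d.top) (hy : y 0 ≠ d.top)
    (h : d.tip i m x = d.tip j n y) : i = j ∧ m = n ∧ x = y := by
  obtain ⟨h0, h1⟩ := wcons_inj h
  exact ⟨h0, rep_inj hx hy h1⟩

theorem tip_ne_const {i j : S} {m : ℕ} {x : ℕ → S} (hx : x 0 ≠ d.top) :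
    d.tip i m x ≠ wcons j fun _ => d.top := fun h => by
  obtain ⟨-, h1⟩ := wcons_inj h
  have : run d.top (m + 1) (rep d.top m x) := fun k _ => congrFun h1 k
  have := le_of_run_rep hx this
  omega

/-- A word that starts like a tip. -/
theorem tip_cases (i : S) (x : ℕ → S) : (∃ m ≥ 1, ∃ y, y 0 ≠ d.top ∧
    d.tip i 3 x = d.tip i (m + 2) y) ∨ d.tip i 3 x = wcons i fun _ => d.top := by
  rcases eq_rep_or_const d.top x with ⟨m, y, hy, rfl⟩ | rfl
  · refine Or.inl ⟨m + 1, by omega, y, hy, ?_⟩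
    rw [tip_add_two _ _ (by omega)]; rfl
  · right
    rw [tip, ← const_eq_rep]

/-- The inverse rules. The tip `i · top ^ ∞` lies in no annulus and needs a rule of its own: it goes
to the corner `base i · side i ^ ∞`, the limit of the towers to which the annuli go. -/
theorem exists_fold (d : HangingData S) : ∃ f : (ℕ → S) → ℕ → S,
    (∀ x, ¬ d.Pat x → f x = wcons (x 0) (f (wtail x))) ∧
    (∀ i ∈ d.hung, ∀ m ≥ 1, ∀ x,
      f (d.tower i (m + 1) x) = d.tower i m (wcons d.top (f x))) ∧
    (∀ i ∈ d.hung, ∀ m ≥ 1, ∀ x, x 0 ≠ d.top → f (d.tip i (m + 2) x) = d.tower i m (f x)) ∧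
    (∀ i ∈ d.hung, ∀ x, f (d.tower i 1 x) = d.tip i 3 (f x)) ∧
    ∀ i ∈ d.hung, f (wcons i fun _ => d.top) = wcons (d.base i) fun _ => d.side i := by
  obtain ⟨f, hf⟩ := exists_transducer (P := fun x l y =>
    (¬ d.Pat x → l = [x 0] ∧ y = wtail x) ∧
    (∀ i ∈ d.hung, ∀ m ≥ 1, ∀ z, x = d.tower i (m + 1) z →
      l = d.towerList i m ++ [d.top] ∧ y = z) ∧
    (∀ i ∈ d.hung, ∀ m ≥ 1, ∀ z, z 0 ≠ d.top → x = d.tip i (m + 2) z →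
      l = d.towerList i m ∧ y = z) ∧
    (∀ i ∈ d.hung, ∀ z, x = d.tower i 1 z → l = d.tipList i 3 ∧ y = z) ∧
    ∀ i ∈ d.hung, (x = wcons i fun _ => d.top) → l = [d.base i] ∧ y = fun _ => d.side i)
    (fun x => by
      by_cases hx : d.Pat x
      · rcases hx with ⟨i, hi, m, hm, y, rfl⟩ | ⟨i, hi, y, rfl⟩
        · have hP : ∀ {p : Prop}, ¬ d.Pat (d.tower i m y) → p :=
            fun h => absurd (Or.inl ⟨i, hi, m, hm, y, rfl⟩) h
          have hT : ∀ {p : Prop} {j}, (d.tower i m y = wcons j fun _ => d.top) → p := by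
            intro p j h
            rw [const_eq_rep d.top 1] at h
            exact absurd h (d.tower_ne_tip hi hm le_rfl)
          rcases Nat.lt_or_ge 1 m with hm1 | hm1
          · refine ⟨d.towerList i (m - 1) ++ [d.top], by simp [towerList], y, hP,
              ?_, ?_, ?_, fun j hj h => hT h⟩
            · intro j hj k hk z h
              obtain ⟨rfl, rfl, rfl⟩ := d.tower_inj hi hj hm (by omega) h
              exact ⟨rfl, rfl⟩
            · exact fun j hj k hk z _ h => absurd h (d.tower_ne_tip hi hm (by omega))
            · intro j hj z h
              obtain ⟨rfl, rfl, rfl⟩ := d.tower_inj hi hj hm (by omega) h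
              omega
          · refine ⟨d.tipList i 3, by simp [tipList], y, hP, ?_, ?_, ?_, fun j hj h => hT h⟩
            · intro j hj k hk z h
              obtain ⟨rfl, rfl, rfl⟩ := d.tower_inj hi hj hm (by omega) h
              omega
            · exact fun j hj k hk z _ h => absurd h (d.tower_ne_tip hi hm (by omega))
            · intro j hj z h
              obtain ⟨rfl, rfl, rfl⟩ := d.tower_inj hi hj hm (by omega) h
              exact ⟨rfl, rfl⟩
        · have hP : ∀ {p : Prop}, ¬ d.Pat (d.tip i 3 y) → p :=
            fun h => absurd (Or.inr ⟨i, hi, y, rfl⟩) h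
          have hT : ∀ {p : Prop} {j k z}, j ∈ d.hung → 1 ≤ k → d.tip i 3 y = d.tower j k z → p :=
            fun hj hk h => absurd h.symm (d.tower_ne_tip hj hk (by norm_num))
          rcases d.tip_cases i y with ⟨m, hm, z, hz, he⟩ | he
          · refine ⟨d.towerList i m, by simp [towerList], z, hP,
              fun j hj k hk z h => hT hj (by omega) h, ?_, fun j hj z h => hT hj le_rfl h, ?_⟩
            · intro j hj k hk w hw h
              obtain ⟨rfl, h1, rfl⟩ := tip_inj hz hw (he.symm.trans h)
              obtain rfl : m = k := by omega
              exact ⟨rfl, rfl⟩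
            · exact fun j hj h => absurd (he.symm.trans h) (tip_ne_const hz)
          · refine ⟨[d.base i], by simp, fun _ => d.side i, hP,
              fun j hj k hk z h => hT hj (by omega) h, ?_, fun j hj z h => hT hj le_rfl h, ?_⟩
            · exact fun j hj k hk w hw h => absurd (h.symm.trans he) (tip_ne_const hw)
            · intro j hj h
              obtain ⟨rfl, -⟩ := wcons_inj (he.symm.trans h)
              exact ⟨rfl, rfl⟩
      · refine ⟨[x 0], by simp, wtail x, fun _ => ⟨rfl, rfl⟩, ?_, ?_, ?_, ?_⟩
        · exact fun i hi m hm z h => absurd (Or.inl ⟨i, hi, m + 1, by omega, _, h⟩) hx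
        · exact fun i hi m hm z _ h =>
            absurd (Or.inr ⟨i, hi, _, h.trans (tip_add_two i m hm z)⟩) hx
        · exact fun i hi z h => absurd (Or.inl ⟨i, hi, 1, le_rfl, _, h⟩) hx
        · intro i hi h
          rw [const_eq_rep d.top 3] at h
          exact absurd (Or.inr ⟨i, hi, _, h⟩) hx)
  refine ⟨f, ?_, ?_, ?_, ?_, ?_⟩
  · intro x hx
    obtain ⟨l, y, ⟨h, -⟩, he⟩ := hf x
    obtain ⟨rfl, rfl⟩ := h hx
    exact he
  · intro i hi m hm x
    obtain ⟨l, y, ⟨-, h, -⟩, he⟩ := hf (d.tower i (m + 1) x)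
    obtain ⟨rfl, rfl⟩ := h i hi m hm x rfl
    rw [he, pre_append, pre_towerList]; rfl
  · intro i hi m hm x hx
    obtain ⟨l, y, ⟨-, -, h, -⟩, he⟩ := hf (d.tip i (m + 2) x)
    obtain ⟨rfl, rfl⟩ := h i hi m hm x hx rfl
    rw [he, pre_towerList]
  · intro i hi x
    obtain ⟨l, y, ⟨-, -, -, h, -⟩, he⟩ := hf (d.tower i 1 x)
    obtain ⟨rfl, rfl⟩ := h i hi x rfl
    rw [he, pre_tipList]
  · intro i hi
    obtain ⟨l, y, ⟨-, -, -, -, h⟩, he⟩ := hf (wcons i fun _ => d.top)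
    obtain ⟨rfl, rfl⟩ := h i hi rfl
    -- The rule for the tip emits only `base i` and passes on the constant word, which contains no
    -- pattern and so is reproduced.
    have hconst : ∀ x : ℕ → S, x = (fun _ => d.side i) → f x = x := by
      intro x hx
      refine eq_of_near_false fun n => near_of_bisim (fun a b => b = (fun _ => d.side i) ∧ a = f b)
        ?_ n _ _ ⟨hx, rfl⟩
      rintro a b ⟨rfl, rfl⟩
      right
      have hnp : ¬ d.Pat fun _ => d.side i := fun h => by
        rw [const_eq_wcons] at h
        exact not_head_wcons_side hi (side_ne_top hi) h.head
      obtain ⟨l, y, ⟨h, -⟩, he⟩ := hf fun _ => d.side i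
      obtain ⟨rfl, rfl⟩ := h hnp
      exact ⟨[d.side i], by simp, _, _, he, const_eq_wcons _, rfl, rfl⟩
    rw [he, hconst _ rfl]; rfl

variable (d) in
/-- Hanging cells can be moved away from the cells from which they hang. -/
theorem exists_detach : ∃ f : (ℕ → S) → ℕ → S,
    (∀ n x y, near (d.rel (· ≠ d.top)) n x y → near d.C (n - 7) (f x) (f y)) ∧
    (∀ n x y, near d.C n (f x) (f y) → near (d.rel (· ≠ d.top)) (n - 7) x y) ∧
    ∀ y, ∃ x, ∀ n, near d.C n (f x) y := by
  obtain ⟨f, f1, f2, f3, f4⟩ := d.exists_unfold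
  obtain ⟨g, g1, g2, g3, g4, g5⟩ := d.exists_fold
  have hf : Coder d f := ⟨f1, fun x hx => by
    rcases hx with ⟨i, hi, m, hm, y, rfl⟩ | ⟨i, hi, y, rfl⟩
    · by_cases hy : y 0 = d.top
      · rw [← wcons_wtail y, hy, f2 i hi m hm]
        exact head_tower hi (by omega) _
      · rw [f3 i hi m hm _ hy]
        exact head_tip hi (by omega) _
    · rw [f4 i hi]
      exact head_tower hi le_rfl _⟩
  have hg : Coder d g := ⟨g1, fun x hx => by
    rcases hx with ⟨i, hi, m, hm, y, rfl⟩ | ⟨i, hi, y, rfl⟩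
    · rcases Nat.lt_or_ge 1 m with hm1 | hm1
      · obtain ⟨m, rfl⟩ := Nat.exists_eq_add_of_le' hm
        rw [g2 i hi m (by omega)]
        exact head_tower hi (by omega) _
      · obtain rfl : m = 1 := by omega
        rw [g4 i hi]
        exact head_tip hi (by norm_num) _
    · rcases d.tip_cases i y with ⟨m, hm, z, hz, he⟩ | he
      · rw [he, g3 i hi m hm z hz]
        exact head_tower hi hm _
      · rw [he, g5 i hi]
        exact Or.inl ⟨i, hi, rfl, rfl⟩⟩
  -- A tower deep in the corner `side i` of `base i` stays there or moves to the tip of `i`, which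
  -- is the same point once hanging contacts count.
  have hfS : ∀ x a t b k, d.C (x 0) a t b → a ≠ d.top → run a (k + 3) (wtail x) →
      ∃ s c, d.same s c (x 0) a ∧ True ∧ f x 0 = s ∧ run c k (wtail (f x)) := by
    intro x a t b k hC ha hx
    by_cases hP : d.Pat x
    · rcases hP with ⟨i, hi, m, hm, y, rfl⟩ | ⟨i, hi, y, rfl⟩
      · obtain rfl : d.side i = a := by
          obtain ⟨m, rfl⟩ := Nat.exists_eq_add_of_le' hm
          exact hx 0 (by omega)
        have hk : k + 3 ≤ m := le_of_run_rep (free_ne_side hi) hx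
        by_cases hy : y 0 = d.top
        · rw [← wcons_wtail y, hy, f2 i hi m hm]
          exact ⟨_, _, Or.inl ⟨rfl, rfl⟩, trivial, rfl, run_rep _ _ (by omega)⟩
        · rw [f3 i hi m hm _ hy]
          exact ⟨_, _, Or.inr (d.contact_base i hi), trivial, rfl, run_rep _ _ (by omega)⟩
      · exact absurd (hx 0 (by omega)).symm ha
    · rw [f1 x hP]
      exact ⟨_, _, Or.inl ⟨rfl, rfl⟩, trivial, rfl,
        (hf.run_apply hC ha hx).mono (by omega)⟩
  -- Conversely, a neighbourhood of the tip of a hung cell moves to the corner from which the cell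
  -- hangs, so no corner of type `top` is left.
  have hgS : ∀ x a t b k, d.C (x 0) a t b → True → run a (k + 3) (wtail x) →
      ∃ s c, d.same s c (x 0) a ∧ c ≠ d.top ∧ g x 0 = s ∧ run c k (wtail (g x)) := by
    intro x a t b k hC _ hx
    by_cases ha : a = d.top
    · subst ha
      have hi := d.mem_hung _ _ _ hC
      obtain ⟨y, hy⟩ := exists_eq_rep hx
      have hxy : x = d.tip (x 0) 3 (rep d.top k y) := by
        rw [tip, ← rep_add, add_comm, ← hy, wcons_wtail]
      set i := x 0
      rcases d.tip_cases i (rep d.top k y) with ⟨m, hm, z, hz, he⟩ | he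
      · rw [hxy, he] at hx
        have hk : k + 3 ≤ m + 2 := le_of_run_rep hz hx
        rw [hxy, he, g3 i hi m hm z hz]
        exact ⟨_, _, Or.inr (d.symm _ _ _ _ (d.contact_base i hi)), side_ne_top hi, rfl,
          run_rep _ _ (by omega)⟩
      · rw [hxy, he, g5 i hi]
        exact ⟨_, _, Or.inr (d.symm _ _ _ _ (d.contact_base i hi)), side_ne_top hi, rfl,
          fun _ _ => rfl⟩
    by_cases hP : d.Pat x
    · rcases hP with ⟨i, hi, m, hm, y, rfl⟩ | ⟨i, hi, y, rfl⟩
      · obtain rfl : d.side i = a := by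
          obtain ⟨m, rfl⟩ := Nat.exists_eq_add_of_le' hm
          exact hx 0 (by omega)
        have hk : k + 3 ≤ m := le_of_run_rep (free_ne_side hi) hx
        obtain ⟨m, rfl⟩ := Nat.exists_eq_add_of_le' hm
        rw [g2 i hi m (by omega)]
        exact ⟨_, _, Or.inl ⟨rfl, rfl⟩, ha, rfl, run_rep _ _ (by omega)⟩
      · exact absurd (hx 0 (by omega)).symm ha
    · rw [g1 x hP]
      exact ⟨_, _, Or.inl ⟨rfl, rfl⟩, ha, rfl,
        (hg.run_apply hC ha hx).mono (by omega)⟩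
  have hfU : ∀ n x y, near (d.rel (· ≠ d.top)) n x y →
      near (d.rel fun _ => True) (n - 7) (f x) (f y) := by
    intro n x y
    refine hf.near_apply hfS ?_
    clear n x y
    rintro _ (⟨i, hi, m, hm, z, rfl⟩ | ⟨i, hi, z, rfl⟩) y h0 n hn h
    · rcases near_rep_side h with ⟨hmn, w, hw, hn'⟩ | ⟨hmn, hr⟩
      · left
        have hy : y = d.tower i m w := by rw [tower, ← hw, ← wcons_wtail y, ← h0]; rfl
        have hzw := near_zero_eq_top (by omega) hn'
        subst hy
        -- The rule depends on whether the next letter is `top`; near words agree on this, because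
        -- the top cell touches nothing.
        by_cases hz : z 0 = d.top
        · have hw0 := hzw.1 hz
          obtain ⟨z, rfl⟩ : ∃ z', z = wcons d.top z' := ⟨wtail z, by rw [← hz, wcons_wtail]⟩
          obtain ⟨w, rfl⟩ : ∃ w', w = wcons d.top w' := ⟨wtail w, by rw [← hw0, wcons_wtail]⟩
          refine ⟨d.towerList i (m + 1), by simp [towerList], z, w, ?_, ?_, ?_, ?_⟩
          · rw [length_towerList]; omega
          · rw [f2 i hi m hm, pre_towerList]
          · rw [f2 i hi m hm, pre_towerList]
          · rw [length_towerList]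
            obtain ⟨q, hq⟩ : ∃ q, n - m - 2 = q + 1 := ⟨n - m - 3, by omega⟩
            rw [hq] at hn'
            rcases hn' with ⟨-, hn'⟩ | ⟨a, b, ⟨hC, -⟩, -⟩
            · exact hn'.anti (by omega)
            · exact (d.not_top _ _ _ hC).elim
        · refine ⟨d.tipList i (m + 2), by simp [tipList], z, w, ?_, ?_, ?_, ?_⟩
          · rw [length_tipList]; omega
          · rw [f3 i hi m hm _ hz, pre_tipList]
          · rw [f3 i hi m hm _ (fun h => hz (hzw.2 h)), pre_tipList]
          · rw [length_tipList]
            exact hn'.anti (by omega)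
      · exact Or.inr ⟨_, _, _, d.symm _ _ _ _ (d.contact_base i hi), side_ne_top hi,
          run_rep _ _ (by omega), hr⟩
    · rcases near_rep_top h with ⟨hmn, w, hw, hn'⟩ | ⟨hmn, hr⟩
      · left
        have hy : y = d.tip i 3 w := by rw [tip, ← hw, ← wcons_wtail y, ← h0]; rfl
        subst hy
        refine ⟨d.towerList i 1, by simp [towerList], z, w, ?_, ?_, ?_, ?_⟩
        · rw [length_towerList]; omega
        · rw [f4 i hi, pre_towerList]
        · rw [f4 i hi, pre_towerList]
        · rw [length_towerList]
          exact hn'.anti (by omega)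
      · omega
  have hgU : ∀ n x y, near (d.rel fun _ => True) n x y →
      near (d.rel (· ≠ d.top)) (n - 7) (g x) (g y) := by
    intro n x y
    refine hg.near_apply hgS ?_
    clear n x y
    rintro _ (⟨i, hi, m, hm, z, rfl⟩ | ⟨i, hi, z, rfl⟩) y h0 n hn h
    · rcases near_rep_side h with ⟨hmn, w, hw, hn'⟩ | ⟨hmn, hr⟩
      · left
        have hy : y = d.tower i m w := by rw [tower, ← hw, ← wcons_wtail y, ← h0]; rfl
        subst hy
        obtain ⟨m, rfl⟩ := Nat.exists_eq_add_of_le' hm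
        rcases Nat.eq_zero_or_pos m with rfl | hm0
        · refine ⟨d.tipList i 3, by simp [tipList], z, w, ?_, ?_, ?_, ?_⟩
          · rw [length_tipList]; omega
          · rw [g4 i hi, pre_tipList]
          · rw [g4 i hi, pre_tipList]
          · rw [length_tipList]
            exact hn'.anti (by omega)
        · refine ⟨d.towerList i m ++ [d.top], by simp [towerList], z, w, ?_, ?_, ?_, ?_⟩
          · rw [List.length_append, length_towerList, List.length_singleton]; omega
          · rw [g2 i hi m hm0, pre_append, pre_towerList]; rfl
          · rw [g2 i hi m hm0, pre_append, pre_towerList]; rfl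
          · rw [List.length_append, length_towerList, List.length_singleton]
            exact hn'.anti (by omega)
      · exact Or.inr ⟨_, _, _, d.symm _ _ _ _ (d.contact_base i hi), trivial,
          run_rep _ _ (by omega), hr⟩
    · rcases d.tip_cases i z with ⟨m, hm, v, hv, he⟩ | he
      · rw [he] at h h0 ⊢
        rcases near_rep_top h with ⟨hmn, w, hw, hn'⟩ | ⟨hmn, hr⟩
        · have hy : y = d.tip i (m + 2) w := by rw [tip, ← hw, ← wcons_wtail y, ← h0]; rfl
          subst hy
          -- If `n = m + 2`, nothing is known about the first letter of `w`, and the rules may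
          -- differ; but then all visible letters are `top`, and both words count as close to the
          -- tip.
          rcases Nat.lt_or_ge (m + 2) n with hmn' | hmn'
          · left
            have hzw := near_zero_eq_top (by omega) hn'
            refine ⟨d.towerList i m, by simp [towerList], v, w, ?_, ?_, ?_, ?_⟩
            · rw [length_towerList]; omega
            · rw [g3 i hi m hm _ hv, pre_towerList]
            · rw [g3 i hi m hm _ (fun h => hv (hzw.2 h)), pre_towerList]
            · rw [length_towerList]
              exact hn'.anti (by omega)
          · exact Or.inr ⟨d.top, _, _, d.contact_base i hi, trivial, run_rep _ _ (by omega),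
              run_rep _ _ (by omega)⟩
        · exact Or.inr ⟨d.top, _, _, d.contact_base i hi, trivial, run_rep _ _ (by omega),
            hr.mono (by omega)⟩
      · rw [he] at h h0 ⊢
        rw [wtail_wcons, const_eq_rep d.top (n + 1)] at h
        rcases near_rep_top h with ⟨hmn, -⟩ | ⟨hmn, hr⟩
        · omega
        · exact Or.inr ⟨d.top, _, _, d.contact_base i hi, trivial, fun _ _ => rfl,
            hr.mono (by omega)⟩
  have hgf : ∀ x, g (f x) = x := by
    intro x
    refine eq_of_near_false fun n => near_of_bisim (fun a b => a = g (f b)) ?_ n _ _ rfl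
    rintro _ x rfl
    right
    by_cases hx : d.Pat x
    · rcases hx with ⟨i, hi, m, hm, y, rfl⟩ | ⟨i, hi, y, rfl⟩
      · by_cases hy : y 0 = d.top
        · obtain ⟨y, rfl⟩ : ∃ y', y = wcons d.top y' := ⟨wtail y, by rw [← hy, wcons_wtail]⟩
          refine ⟨d.towerList i m, by simp [towerList], wcons d.top (g (f y)), wcons d.top y,
            ?_, ?_, ?_⟩
          · rw [f2 i hi m hm, g2 i hi m hm, pre_towerList]
          · rw [pre_towerList]
          · have h1 : ∀ z, ¬ d.Pat (wcons d.top z) := fun z h => not_head_wcons_top z h.head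
            rw [f1 _ (h1 _)]
            exact (g1 _ (h1 _)).symm
        · refine ⟨d.towerList i m, by simp [towerList], g (f y), y, ?_, ?_, rfl⟩
          · rw [f3 i hi m hm _ hy, g3 i hi m hm _ (hf.apply_zero_ne_top hy), pre_towerList]
          · rw [pre_towerList]
      · refine ⟨d.tipList i 3, by simp [tipList], g (f y), y, ?_, ?_, rfl⟩
        · rw [f4 i hi, g4 i hi, pre_tipList]
        · rw [pre_tipList]
    · refine ⟨[x 0], by simp, _, wtail x, ?_, (wcons_wtail x).symm, rfl⟩
      have h1 := hf.not_pat hx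
      rw [g1 _ h1, f1 x hx]; rfl
  -- Only nearness at all levels can be claimed here, not equality: the tip `i · top ^ ∞` is first
  -- sent to the corner `base i · side i ^ ∞`, a different word for the same point.
  have hfg : ∀ y n, near (d.rel fun _ => True) n (f (g y)) y := by
    intro y n
    refine near_of_bisim (fun a b => a = f (g b)) ?_ n _ _ rfl
    rintro _ x rfl
    by_cases hx : d.Pat x
    · rcases hx with ⟨i, hi, m, hm, y, rfl⟩ | ⟨i, hi, y, rfl⟩
      · right
        obtain ⟨m, rfl⟩ := Nat.exists_eq_add_of_le' hm
        refine ⟨d.towerList i (m + 1), by simp [towerList], f (g y), y, ?_, ?_, rfl⟩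
        · rcases Nat.eq_zero_or_pos m with rfl | hm0
          · rw [g4 i hi, f4 i hi, pre_towerList]
          · rw [g2 i hi m hm0, f2 i hi m hm0, pre_towerList]
        · rw [pre_towerList]
      · rcases d.tip_cases i y with ⟨m, hm, z, hz, he⟩ | he
        · right
          refine ⟨d.tipList i (m + 2), by simp [tipList], f (g z), z, ?_, ?_, rfl⟩
          · rw [he, g3 i hi m hm z hz, f3 i hi m hm _ (hg.apply_zero_ne_top hz), pre_tipList]
          · rw [he, pre_tipList]
        · left
          have hinv := hgf (wcons (d.base i) fun _ => d.side i)
          intro n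
          have hr : ∀ k, run (d.side i) k (wtail (f (wcons (d.base i) fun _ => d.side i))) ∧
              f (wcons (d.base i) fun _ => d.side i) 0 = d.base i := by
            intro k
            have hnp : ¬ d.Pat (wcons (d.base i) fun _ => d.side i) := by
              rintro (⟨j, hj, m, hm, z, h⟩ | ⟨j, hj, z, h⟩)
              · obtain ⟨-, h⟩ := wcons_inj h
                obtain ⟨m, rfl⟩ := Nat.exists_eq_add_of_le' hm
                have h1 : d.side i = d.side j := congrFun h 0
                have : run (d.side j) (m + 2) (rep (d.side j) (m + 1)
                    (wcons d.free (wcons d.top z))) := fun k _ => by rw [← h, h1]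
                have := le_of_run_rep (free_ne_side hj) this
                omega
              · exact side_ne_top hi (congrFun h 1)
            rw [f1 _ hnp]
            exact ⟨hf.run_apply (d.symm _ _ _ _ (d.contact_base i hi)) (side_ne_top hi)
              (fun _ _ => rfl), rfl⟩
          rw [he, g5 i hi]
          exact (near_of_same (Or.inr (d.symm _ _ _ _ (d.contact_base i hi))) trivial trivial
            (hr n).2 (hr n).1 rfl fun _ _ => rfl).anti n.le_succ
    · right
      refine ⟨[x 0], by simp, _, wtail x, ?_, (wcons_wtail x).symm, rfl⟩
      have h1 := hg.not_pat hx
      rw [f1 _ h1, g1 x hx]; rfl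
  have hC : ∀ {n x y}, near (d.rel fun _ => True) n x y → near d.C n x y :=
    fun h => h.imp fun _ _ _ _ h => h.1
  refine ⟨f, fun n x y h => hC (hfU n x y h), fun n x y h => ?_, fun y => ⟨g y, fun n => hC (hfg y n)⟩⟩
  have := hgU n _ _ (h.imp fun s a t b h => (⟨h, trivial, trivial⟩ : d.rel (fun _ => True) s a t b))
  rwa [hgf, hgf] at this

end HangingData

/-! ### Contacts in a gasket, and a coding with horizontal contacts only. -/

namespace FractalGasket

variable {K : FractalGasket}

/-- The cell of `t` is the right neighbour of the cell of `s`. -/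
def Adj (K : FractalGasket) (s t : Fin K.N) : Prop := K.map s omegaBeta = K.map t omegaAlpha

/-- The contacts of horizontal neighbours. -/
def Horizontal (K : FractalGasket) (α β s a t b : Fin K.N) : Prop :=
  (a = β ∧ b = α ∧ K.Adj s t) ∨ (a = α ∧ b = β ∧ K.Adj t s)

theorem omegaGamma_mem_carrier {a : Fin K.N} (h : K.map a omegaGamma = omegaGamma) :
    omegaGamma ∈ K.carrier := by
  have h1 := K.code_eq fun _ => a
  have : wtail (fun _ : ℕ => a) = fun _ => a := rfl
  rw [this] at h1
  rw [fixed_unique h h1.symm]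
  exact K.code_mem _

theorem Adj.ne {s t : Fin K.N} (h : K.Adj s t) : s ≠ t := by
  rintro rfl
  exact omegaAlpha_ne_omegaBeta (K.map_injective s h).symm

section Contact

theorem Contact.symm {s a t b : Fin K.N} (h : K.Contact s a t b) : K.Contact t b s a := by
  obtain ⟨hst, v, hv, w, hw, ha, hb, h⟩ := h
  exact ⟨hst.symm, w, hw, v, hv, hb, ha, h.symm⟩

theorem Contact.trans {s a t b u c : Fin K.N} (h : K.Contact s a t b) (h' : K.Contact t b u c) :
    (s = u ∧ a = c) ∨ K.Contact s a u c := by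
  obtain ⟨-, v, hv, w, hw, ha, hb, h⟩ := h
  obtain ⟨-, w', hw', x, hx, hb', hc, h'⟩ := h'
  obtain rfl := fixed_unique hb hb'
  by_cases hsu : s = u
  · subst hsu
    obtain rfl := K.map_injective s (h.trans h')
    exact Or.inl ⟨rfl, eq_of_map_vertex_eq hv (ha.trans hc.symm)⟩
  · exact Or.inr ⟨hsu, v, hv, x, hx, ha, hc, h.trans h'⟩

theorem Contact.type_ne {s a t b : Fin K.N} (h : K.Contact s a t b) : a ≠ b := by
  obtain ⟨hst, v, hv, w, hw, ha, hb, h⟩ := h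
  rintro rfl
  obtain rfl := fixed_unique ha hb
  exact hst (eq_of_map_vertex_eq hv h)

theorem Contact.not_self {a t b : Fin K.N} (h : K.Contact a a t b) : False := by
  obtain ⟨hst, v, hv, w, hw, ha, hb, h⟩ := h
  obtain rfl := eq_of_map_eq_vertex (triangleVertices_subset hw) hv (h.symm.trans ha)
  exact hst (eq_of_map_vertex_eq hw h)

theorem Contact.of_horizontal {α β : Fin K.N} (hα : K.map α omegaAlpha = omegaAlpha)
    (hβ : K.map β omegaBeta = omegaBeta) {s a t b : Fin K.N} (h : K.Horizontal α β s a t b) :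
    K.Contact s a t b := by
  rcases h with ⟨rfl, rfl, h⟩ | ⟨rfl, rfl, h⟩
  · exact ⟨h.ne, _, omegaBeta_mem, _, omegaAlpha_mem, hβ, hα, h⟩
  · exact ⟨h.ne.symm, _, omegaAlpha_mem, _, omegaBeta_mem, hα, hβ, h.symm⟩

/-- Without the top vertex, the two types are `α` and `β`, as they differ; so the right corner of
one cell is the left corner of the other. -/
theorem Contact.horizontal {α β : Fin K.N} (hα : K.map α omegaAlpha = omegaAlpha)
    (hβ : K.map β omegaBeta = omegaBeta) {s a t b : Fin K.N} (h : K.Contact s a t b)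
    (ha : K.map a omegaGamma ≠ omegaGamma) (hb : K.map b omegaGamma ≠ omegaGamma) :
    K.Horizontal α β s a t b := by
  obtain ⟨hst, v, hv, w, hw, ha', hb', h⟩ := h
  have hvw : v ≠ w := by
    rintro rfl
    exact hst (eq_of_map_vertex_eq hv h)
  rcases hv with rfl | rfl | rfl
  · obtain rfl := eq_of_map_vertex_eq omegaAlpha_mem (ha'.trans hα.symm)
    rcases hw with rfl | rfl | rfl
    · exact absurd rfl hvw
    · obtain rfl := eq_of_map_vertex_eq omegaBeta_mem (hb'.trans hβ.symm)
      exact Or.inr ⟨rfl, rfl, h.symm⟩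
    · exact absurd hb' hb
  · obtain rfl := eq_of_map_vertex_eq omegaBeta_mem (ha'.trans hβ.symm)
    rcases hw with rfl | rfl | rfl
    · obtain rfl := eq_of_map_vertex_eq omegaAlpha_mem (hb'.trans hα.symm)
      exact Or.inl ⟨rfl, rfl, h⟩
    · exact absurd rfl hvw
    · exact absurd hb' hb
  · exact absurd ha' ha

theorem map_apply_one_sub (j : Fin K.N) (z w : Plane) :
    K.map j z 1 - K.map j w 1 = K.ratio j * (z 1 - w 1) := by
  simpa using congrArg (fun z : Plane => z 1) (K.map_sub j z w)

theorem height_eq_zero {v : Plane} (hv : v ∈ triangleVertices) (h : v ≠ omegaGamma) : v 1 = 0 := by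
  rcases hv with rfl | rfl | rfl
  · simp [omegaAlpha]
  · simp [omegaBeta]
  · exact absurd rfl h

theorem height_omegaGamma_pos : 0 < omegaGamma 1 := by
  simp [omegaGamma]

theorem height_lt {v : Plane} (hv : v ∈ triangleVertices) (h : v ≠ omegaGamma) (j : Fin K.N) :
    K.map j v 1 < K.map j omegaGamma 1 := by
  have h1 := K.map_apply_one_sub j omegaGamma v
  rw [height_eq_zero hv h] at h1
  have := mul_pos (K.ratio_pos j) height_omegaGamma_pos
  linarith

variable {c : Fin K.N} (hc : K.map c omegaGamma = omegaGamma)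
include hc

theorem Contact.of_top {i t b : Fin K.N} (h : K.Contact i c t b) :
    ∃ w ∈ triangleVertices, w ≠ omegaGamma ∧ K.map b w = w ∧
      K.map i omegaGamma = K.map t w := by
  obtain ⟨hst, v, hv, w, hw, ha, hb, h⟩ := h
  obtain rfl := fixed_unique ha hc
  refine ⟨w, hw, ?_, hb, h⟩
  rintro rfl
  exact hst (eq_of_map_vertex_eq hw h)

/-- The point where `i` hangs is a bottom corner of `t` and has positive height, being the top of a
cell in the triangle. A cell at a bottom corner of the triangle has its own bottom side at height
zero, and the cell at the top is isolated. -/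
theorem Contact.not_corner (hiso : ∀ a t b, ¬ K.Contact c a t b) {i t b s u d : Fin K.N}
    (h : K.Contact i c t b) (h' : K.Contact s t u d) : False := by
  obtain ⟨w, hw, hwγ, -, hiw⟩ := h.of_top hc
  obtain ⟨-, v, hv, -, -, ht, -⟩ := h'
  by_cases hvγ : v = omegaGamma
  · subst hvγ
    obtain rfl := eq_of_map_vertex_eq hv (ht.trans hc.symm)
    exact hiso _ _ _ h.symm
  · have h1 := K.map_apply_one_sub t w v
    rw [height_eq_zero hw hwγ, ht, height_eq_zero hv hvγ, ← hiw] at h1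
    have h2 := height_lt omegaAlpha_mem omegaAlpha_ne_omegaGamma i
    have h3 := height_nonneg (K.map_mem_triangle i (triangleVertices_subset omegaAlpha_mem))
    linarith

end Contact

/-- The gasket is coded by words whose only identifications come from horizontal neighbours. -/
theorem exists_horizontal_coding (hK : K.TopIsolated ∨ omegaGamma ∉ K.carrier) {α β : Fin K.N}
    (hα : K.map α omegaAlpha = omegaAlpha) (hβ : K.map β omegaBeta = omegaBeta) :
    ∃ f : (ℕ → Fin K.N) → ℕ → Fin K.N,
      (∀ n x y, near (K.Horizontal α β) n x y → near K.Contact (n - 7) (f x) (f y)) ∧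
      (∀ n x y, near K.Contact n (f x) (f y) → near (K.Horizontal α β) (n - 7) x y) ∧
      ∀ y, ∃ x, ∀ n, near K.Contact n (f x) y := by
  by_cases hno : ∀ s a t b, K.Contact s a t b → K.map a omegaGamma ≠ omegaGamma
  · refine ⟨id, fun n x y h => ?_, fun n x y h => ?_, fun y => ⟨y, fun n => near_refl _ _ _⟩⟩
    · exact (h.imp fun s a t b h => Contact.of_horizontal hα hβ h).anti (Nat.sub_le _ _)
    · exact (h.imp fun s a t b h =>
        h.horizontal hα hβ (hno _ _ _ _ h) (hno _ _ _ _ h.symm)).anti (Nat.sub_le _ _)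
  push Not at hno
  obtain ⟨i₀, a, t₀, b₀, h₀, ha⟩ := hno
  obtain ⟨-, c, hc, hdisj⟩ := hK.resolve_right (not_not.2 (omegaGamma_mem_carrier ha))
  obtain rfl := eq_of_map_vertex_eq omegaGamma_mem (ha.trans hc.symm)
  have hiso : ∀ b t b', ¬ K.Contact a b t b' := by
    rintro b t b' ⟨hst, v, hv, w, hw, -, -, h⟩
    exact Set.disjoint_left.1 (hdisj t hst.symm) ⟨v, triangleVertices_subset hv, rfl⟩
      ⟨w, triangleVertices_subset hw, h.symm⟩
  have hex : ∀ i, ∃ p : Fin K.N × Fin K.N, (∃ t b, K.Contact i a t b) → K.Contact i a p.1 p.2 := by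
    intro i
    by_cases h : ∃ t b, K.Contact i a t b
    · obtain ⟨t, b, h⟩ := h
      exact ⟨(t, b), fun _ => h⟩
    · exact ⟨(a, a), fun h' => absurd h' h⟩
  choose p hp using hex
  -- Among the cells from which something hangs, take one whose top is highest. It is not at a
  -- corner, and it hangs from nothing, for the cell above it would have a higher top.
  obtain ⟨τ, ⟨i₁, b₁, h₁⟩, hτ⟩ := Set.exists_max_image {t | ∃ i b, K.Contact i a t b}
    (fun t => K.map t omegaGamma 1) (Set.toFinite _) ⟨t₀, i₀, b₀, h₀⟩
  let d : HangingData (Fin K.N) :=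
    { C := K.Contact
      top := a
      free := τ
      hung := {i | ∃ t b, K.Contact i a t b}
      base := fun i => (p i).1
      side := fun i => (p i).2
      symm := fun _ _ _ _ h => h.symm
      trans := fun _ _ _ _ _ _ h h' => h.trans h'
      type_ne := fun _ _ _ _ h => h.type_ne
      not_self := fun _ _ _ h => h.not_self
      not_top := hiso
      contact_base := fun i hi => hp i hi
      mem_hung := fun i t b h => ⟨t, b, h⟩
      base_not_corner := fun i hi _ _ _ h => (hp i hi).not_corner hc hiso h
      free_not_corner := fun _ _ _ h => h₁.not_corner hc hiso h
      free_not_hung := by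
        rintro ⟨t, b, h⟩
        obtain ⟨w, hw, hwγ, -, hw'⟩ := h.of_top hc
        have h2 : K.map t omegaGamma 1 ≤ K.map τ omegaGamma 1 := hτ t ⟨τ, b, h⟩
        have h3 := height_lt hw hwγ t
        rw [hw'] at h2
        linarith }
  have hne : ∀ b, b ≠ a → K.map b omegaGamma ≠ omegaGamma := fun b hb h =>
    hb (eq_of_map_vertex_eq omegaGamma_mem (h.trans hc.symm))
  have hαa : α ≠ a := by
    rintro rfl
    exact omegaAlpha_ne_omegaGamma (fixed_unique hα hc)
  have hβa : β ≠ a := by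
    rintro rfl
    exact omegaBeta_ne_omegaGamma (fixed_unique hβ hc)
  obtain ⟨f, h1, h2, h3⟩ := d.exists_detach
  refine ⟨f, fun n x y h => h1 n x y (h.imp fun s x t y h => ?_), fun n x y h =>
    (h2 n x y h).imp fun s x t y h => ?_, h3⟩
  · refine ⟨Contact.of_horizontal hα hβ h, ?_⟩
    rcases h with ⟨rfl, rfl, -⟩ | ⟨rfl, rfl, -⟩
    · exact ⟨hβa, hαa⟩
    · exact ⟨hαa, hβa⟩
  · exact Contact.horizontal hα hβ h.1 (hne _ h.2.1) (hne _ h.2.2)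

/-- Distances in the gasket are controlled by a coding by words in which only horizontal neighbours
touch. -/
theorem exists_metric_coding (hK : K.TopIsolated ∨ omegaGamma ∉ K.carrier) {α β : Fin K.N}
    (hα : K.map α omegaAlpha = omegaAlpha) (hβ : K.map β omegaBeta = omegaBeta) {ρ R : ℝ}
    (hρ0 : 0 < ρ) (hR1 : R < 1) (hρ : ∀ j, ρ ≤ K.ratio j) (hR : ∀ j, K.ratio j ≤ R) :
    ∃ b : (ℕ → Fin K.N) → K.carrier, Function.Surjective b ∧ ∃ C > 0, ∃ c > 0,
      (∀ n x y, near (K.Horizontal α β) n x y → dist (b x) (b y) ≤ C * R ^ n) ∧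
      ∀ n x y, ¬ near (K.Horizontal α β) n x y → c * ρ ^ n ≤ dist (b x) (b y) := by
  obtain ⟨f, h1, h2, h3⟩ := exists_horizontal_coding hK hα hβ
  have hρR : ρ ≤ R := (hρ α).trans (hR α)
  have hR0 : 0 < R := hρ0.trans_le hρR
  have hρ1 : ρ ≤ 1 := hρR.trans hR1.le
  obtain ⟨c, hc0, hc⟩ := exists_le_dist_code_of_not_near hρ0 hρ1 hρ
  -- The seven levels lost in detaching become the factors `(R ^ 7)⁻¹` and `ρ ^ 7`.
  refine ⟨fun x => ⟨K.code (f x), K.code_mem _⟩, ?_, 2 * (R ^ 7)⁻¹, by positivity,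
    c * ρ ^ 7, by positivity, fun n x y h => ?_, fun n x y h => ?_⟩
  · rintro ⟨z, hz⟩
    obtain ⟨y, rfl⟩ := K.exists_code_eq hz
    obtain ⟨x, hx⟩ := h3 y
    refine ⟨x, Subtype.ext (dist_eq_zero.1 (eq_zero_of_forall_le_pow (B := 2) dist_nonneg hR0.le hR1
      fun n => ?_))⟩
    rw [mul_comm]
    exact dist_code_le_of_near hR (hx n)
  · refine (dist_code_le_of_near hR (h1 n x y h)).trans ?_
    have : R ^ 7 * R ^ (n - 7) ≤ R ^ n := by
      rw [← pow_add]
      exact pow_le_pow_of_le_one hR0.le hR1.le (by omega)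
    have h7 : 0 < R ^ 7 := by positivity
    rw [mul_assoc]
    refine mul_le_mul_of_nonneg_left ?_ (by norm_num)
    rw [inv_mul_eq_div, le_div_iff₀ h7, mul_comm]
    exact this
  · have h4 : ¬ near K.Contact (n + 7) (f x) (f y) := fun h' => h (by simpa using h2 _ _ _ h')
    have := hc _ _ _ h4
    rw [pow_add] at this
    change _ ≤ dist (K.code (f x)) (K.code (f y))
    linarith

end FractalGasket

/-! ### Horizontal blocks and the bijection of symbols. -/

namespace FractalGasket

variable {K : FractalGasket}

theorem Adj.left_unique {s s' t : Fin K.N} (h : K.Adj s t) (h' : K.Adj s' t) : s = s' :=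
  eq_of_map_vertex_eq omegaBeta_mem (h.trans h'.symm)

theorem Adj.right_unique {s t t' : Fin K.N} (h : K.Adj s t) (h' : K.Adj s t') : t = t' :=
  eq_of_map_vertex_eq omegaAlpha_mem (h.symm.trans h')

theorem Adj.lt {s t : Fin K.N} (h : K.Adj s t) :
    K.map s omegaAlpha 0 < K.map t omegaAlpha 0 := by
  have h1 := congrArg (fun z : Plane => z 0) (K.map_sub s omegaBeta omegaAlpha)
  rw [show K.map s omegaBeta = K.map t omegaAlpha from h] at h1
  have h2 := K.ratio_pos s
  simp [omegaAlpha, omegaBeta] at h1 ⊢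
  linarith

/-- The symbols of a block, listed from left to right. -/
theorem IsHorizontalBlock.exists_list {I : Finset (Fin K.N)} (hI : K.IsHorizontalBlock I) :
    ∃ l : List (Fin K.N), l.Nodup ∧ l.toFinset = I ∧ l.IsChain K.Adj := hI.prop

/-- Left corners move strictly to the right along a chain. Hence a chain never repeats a symbol, and
a row extended by a neighbour is again a row, which maximality of a block forbids. -/
theorem isChain_pairwise_lt {l : List (Fin K.N)} (hl : l.IsChain K.Adj) :
    l.Pairwise fun s t => K.map s omegaAlpha 0 < K.map t omegaAlpha 0 := by
  have : l.IsChain fun s t => K.map s omegaAlpha 0 < K.map t omegaAlpha 0 :=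
    hl.imp fun _ _ h => h.lt
  have htr : Trans (fun s t : Fin K.N => K.map s omegaAlpha 0 < K.map t omegaAlpha 0)
      (fun s t : Fin K.N => K.map s omegaAlpha 0 < K.map t omegaAlpha 0)
      (fun s t : Fin K.N => K.map s omegaAlpha 0 < K.map t omegaAlpha 0) := ⟨lt_trans⟩
  exact List.isChain_iff_pairwise.1 this

/-- In the list of a block, the right neighbour of a symbol comes next. -/
theorem IsHorizontalBlock.getElem_succ {I : Finset (Fin K.N)} (hI : K.IsHorizontalBlock I)
    {l : List (Fin K.N)} (hlI : l.toFinset = I) (hl : l.IsChain K.Adj) {k : ℕ}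
    (hk : k < l.length) {t : Fin K.N} (h : K.Adj l[k] t) :
    ∃ hk' : k + 1 < l.length, l[k + 1] = t := by
  by_cases hk' : k + 1 < l.length
  · exact ⟨hk', (List.isChain_iff_getElem.1 hl k hk').right_unique h⟩
  exfalso
  have hlast : l.getLast? = some l[k] := by
    rw [List.getLast?_eq_getElem?, show l.length - 1 = k by omega, List.getElem?_eq_getElem hk]
  have hchain : (l ++ [t]).IsChain K.Adj := by
    rw [List.isChain_append]
    refine ⟨hl, List.isChain_singleton _, ?_⟩
    intro x hx y hy
    rw [hlast] at hx
    simp at hx hy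
    rw [← hx, ← hy]; exact h
  have hnd : (l ++ [t]).Nodup :=
    (isChain_pairwise_lt hchain).imp fun h => fun he => by rw [he] at h; exact lt_irrefl _ h
  have hrow : K.IsHorizontalRow (l ++ [t]).toFinset := ⟨_, hnd, rfl, hchain⟩
  have hle : I ≤ (l ++ [t]).toFinset := by
    rw [← hlI]; intro x hx; simp at hx ⊢; exact Or.inr hx
  have ht : t ∈ I := hI.le_of_ge hrow hle (by simp)
  rw [← hlI] at ht
  have := List.nodup_append.1 hnd
  exact this.2.2 t (by simpa using ht) t (by simp) rfl

/-- In the list of a block, the left neighbour of a symbol comes just before. -/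
theorem IsHorizontalBlock.getElem_pred {I : Finset (Fin K.N)} (hI : K.IsHorizontalBlock I)
    {l : List (Fin K.N)} (hlI : l.toFinset = I) (hl : l.IsChain K.Adj) {k : ℕ}
    (hk : k < l.length) {s : Fin K.N} (h : K.Adj s l[k]) :
    ∃ m, ∃ hm : m < l.length, m + 1 = k ∧ l[m] = s := by
  rcases k with _ | k
  swap
  · exact ⟨k, by omega, rfl, (List.isChain_iff_getElem.1 hl k hk).left_unique h⟩
  exfalso
  obtain ⟨u, l, rfl⟩ := List.exists_cons_of_length_pos hk
  have hchain : (s :: u :: l).IsChain K.Adj := List.isChain_cons_cons.2 ⟨h, hl⟩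
  have hnd : (s :: u :: l).Nodup :=
    (isChain_pairwise_lt hchain).imp fun h => fun he => by rw [he] at h; exact lt_irrefl _ h
  have hrow : K.IsHorizontalRow (s :: u :: l).toFinset := ⟨_, hnd, rfl, hchain⟩
  have hle : I ≤ (s :: u :: l).toFinset := by
    rw [← hlI]; intro x hx; simp at hx ⊢; exact Or.inr hx
  have ht : s ∈ I := hI.le_of_ge hrow hle (by simp)
  rw [← hlI, List.mem_toFinset] at ht
  exact (List.nodup_cons.1 hnd).1 ht

/-- A block contains the neighbours of its members, so walking along the list of `I` in both
directions from `s` never leaves `J`. Thus blocks partition the symbols. -/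
theorem IsHorizontalBlock.subset_of_mem {I J : Finset (Fin K.N)} (hI : K.IsHorizontalBlock I)
    (hJ : K.IsHorizontalBlock J) {s : Fin K.N} (hsI : s ∈ I) (hsJ : s ∈ J) : I ⊆ J := by
  obtain ⟨l, -, hlI, hl⟩ := hI.exists_list
  obtain ⟨l', -, hlJ, hl'⟩ := hJ.exists_list
  have hsucc : ∀ x y, K.Adj x y → x ∈ J → y ∈ J := by
    intro x y h hx
    rw [← hlJ, List.mem_toFinset] at hx ⊢
    obtain ⟨k, hk, rfl⟩ := List.getElem_of_mem hx
    obtain ⟨hk', rfl⟩ := hJ.getElem_succ hlJ hl' hk h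
    exact List.getElem_mem _
  have hpred : ∀ x y, K.Adj x y → y ∈ J → x ∈ J := by
    intro x y h hy
    rw [← hlJ, List.mem_toFinset] at hy ⊢
    obtain ⟨k, hk, rfl⟩ := List.getElem_of_mem hy
    obtain ⟨m, hm, -, rfl⟩ := hJ.getElem_pred hlJ hl' hk h
    exact List.getElem_mem _
  rw [← hlI, List.mem_toFinset] at hsI
  obtain ⟨k, hk, rfl⟩ := List.getElem_of_mem hsI
  have hup : ∀ m, ∀ hm : m < l.length, k ≤ m → l[m] ∈ J := by
    intro m hm hkm
    induction m, hkm using Nat.le_induction with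
    | base => exact hsJ
    | succ m _ ih =>
      exact hsucc _ _ (List.isChain_iff_getElem.1 hl m hm) (ih (by omega))
  have hdown : ∀ m, ∀ hm : m ≤ k, l[k - m]'(by omega) ∈ J := by
    intro m
    induction m with
    | zero => exact fun _ => hsJ
    | succ m ih =>
      intro hm
      have h1 := List.isChain_iff_getElem.1 hl (k - (m + 1)) (by omega)
      refine hpred _ _ h1 ?_
      have h2 := ih (by omega)
      simpa only [show k - (m + 1) + 1 = k - m by omega] using h2
  intro x hx
  rw [← hlI, List.mem_toFinset] at hx
  obtain ⟨m, hm, rfl⟩ := List.getElem_of_mem hx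
  rcases le_total k m with h | h
  · exact hup m hm h
  · have := hdown (k - m) (by omega)
    simpa only [show k - (k - m) = m by omega] using this

theorem IsHorizontalBlock.eq_of_mem {I J : Finset (Fin K.N)} (hI : K.IsHorizontalBlock I)
    (hJ : K.IsHorizontalBlock J) {s : Fin K.N} (hsI : s ∈ I) (hsJ : s ∈ J) : I = J :=
  (hI.subset_of_mem hJ hsI hsJ).antisymm (hJ.subset_of_mem hI hsJ hsI)

theorem exists_block (s : Fin K.N) : ∃ I, K.IsHorizontalBlock I ∧ s ∈ I := by
  have hs : K.IsHorizontalRow {s} := ⟨[s], by simp, by simp, List.isChain_singleton _⟩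
  obtain ⟨I, hle, hI⟩ := Set.Finite.exists_le_maximal
    (Set.toFinite {I : Finset (Fin K.N) | K.IsHorizontalRow I}) hs
  exact ⟨I, hI, hle (by simp)⟩

variable (K) in
/-- The list of the symbols of a block, from left to right. -/
noncomputable def blockList (I : {I : Finset (Fin K.N) // K.IsHorizontalBlock I}) :
    List (Fin K.N) := I.2.exists_list.choose

theorem blockList_spec (I : {I : Finset (Fin K.N) // K.IsHorizontalBlock I}) :
    (K.blockList I).Nodup ∧ (K.blockList I).toFinset = I.1 ∧ (K.blockList I).IsChain K.Adj :=
  I.2.exists_list.choose_spec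

theorem length_blockList (I : {I : Finset (Fin K.N) // K.IsHorizontalBlock I}) :
    (K.blockList I).length = I.1.card := by
  rw [← (blockList_spec I).2.1, List.toFinset_card_of_nodup (blockList_spec I).1]

theorem mem_blockList {I : {I : Finset (Fin K.N) // K.IsHorizontalBlock I}} {s : Fin K.N} :
    s ∈ K.blockList I ↔ s ∈ I.1 := by
  rw [← (blockList_spec I).2.1, List.mem_toFinset]

theorem exists_getElem_blockList (s : Fin K.N) :
    ∃ I : {I : Finset (Fin K.N) // K.IsHorizontalBlock I}, ∃ k : ℕ,
      (K.blockList I)[k]? = some s := by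
  obtain ⟨I, hI, hs⟩ := exists_block s
  have h1 : s ∈ K.blockList ⟨I, hI⟩ := mem_blockList.2 hs
  obtain ⟨k, hk, h⟩ := List.getElem_of_mem h1
  exact ⟨⟨I, hI⟩, k, by rw [List.getElem?_eq_getElem hk, h]⟩

theorem blockList_inj {I J : {I : Finset (Fin K.N) // K.IsHorizontalBlock I}} {k m : ℕ}
    {s : Fin K.N} (hk : (K.blockList I)[k]? = some s) (hm : (K.blockList J)[m]? = some s) :
    I = J ∧ k = m := by
  have h1 := mem_blockList.1 (List.mem_of_getElem? hk)
  have h2 := mem_blockList.1 (List.mem_of_getElem? hm)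
  obtain rfl : I = J := Subtype.ext (I.2.eq_of_mem J.2 h1 h2)
  refine ⟨rfl, ?_⟩
  obtain ⟨hk', rfl⟩ := List.getElem?_eq_some_iff.1 hk
  obtain ⟨hm', he⟩ := List.getElem?_eq_some_iff.1 hm
  exact ((blockList_spec I).1.getElem_inj_iff.1 he).symm

theorem adj_iff {I : {I : Finset (Fin K.N) // K.IsHorizontalBlock I}} {k : ℕ}
    {s t : Fin K.N} (hk : (K.blockList I)[k]? = some s) :
    K.Adj s t ↔ (K.blockList I)[k + 1]? = some t := by
  obtain ⟨-, h2, h3⟩ := blockList_spec I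
  obtain ⟨hk', rfl⟩ := List.getElem?_eq_some_iff.1 hk
  constructor
  · intro h
    obtain ⟨hk2, he⟩ := I.2.getElem_succ h2 h3 hk' h
    rw [List.getElem?_eq_getElem hk2, he]
  · intro h
    obtain ⟨hk2, rfl⟩ := List.getElem?_eq_some_iff.1 h
    exact List.isChain_iff_getElem.1 h3 k hk2

theorem not_adj_alpha {α : Fin K.N} (hα : K.map α omegaAlpha = omegaAlpha) (s : Fin K.N) :
    ¬ K.Adj s α := fun h =>
  omegaAlpha_ne_omegaBeta (eq_of_map_eq_vertex (triangleVertices_subset omegaBeta_mem)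
    omegaAlpha_mem (h.trans hα)).symm

theorem not_adj_beta {β : Fin K.N} (hβ : K.map β omegaBeta = omegaBeta) (t : Fin K.N) :
    ¬ K.Adj β t := fun h =>
  omegaAlpha_ne_omegaBeta (eq_of_map_eq_vertex (triangleVertices_subset omegaAlpha_mem)
    omegaBeta_mem (h.symm.trans hβ))

theorem getElem_alpha {I : {I : Finset (Fin K.N) // K.IsHorizontalBlock I}} {α : Fin K.N}
    (hα : K.map α omegaAlpha = omegaAlpha) (hI : α ∈ I.1) : (K.blockList I)[0]? = some α := by
  obtain ⟨k, hk, h⟩ := List.getElem_of_mem (mem_blockList.2 hI)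
  rcases k with _ | k
  · rw [List.getElem?_eq_getElem hk, h]
  · exact (not_adj_alpha hα _ (h ▸ List.isChain_iff_getElem.1 (blockList_spec I).2.2 k hk)).elim

theorem getElem_beta {I : {I : Finset (Fin K.N) // K.IsHorizontalBlock I}} {β : Fin K.N}
    (hβ : K.map β omegaBeta = omegaBeta) (hI : β ∈ I.1) :
    (K.blockList I)[I.1.card - 1]? = some β := by
  obtain ⟨k, hk, h⟩ := List.getElem_of_mem (mem_blockList.2 hI)
  have hk' : k + 1 = (K.blockList I).length := by
    by_contra hne
    exact not_adj_beta hβ _ (h ▸ List.isChain_iff_getElem.1 (blockList_spec I).2.2 k (by omega))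
  rw [← length_blockList, ← hk', Nat.add_sub_cancel, List.getElem?_eq_getElem hk, h]

/-- The map of symbols that is induced by a size preserving map of blocks. -/
theorem exists_symbol_map {E F : FractalGasket}
    (h : {I : Finset (Fin E.N) // E.IsHorizontalBlock I} →
      {J : Finset (Fin F.N) // F.IsHorizontalBlock J})
    (hsize : ∀ I, (h I).1.card = I.1.card) :
    ∃ σ : Fin E.N → Fin F.N, ∀ (I) (k : ℕ) (s), (E.blockList I)[k]? = some s →
      (F.blockList (h I))[k]? = some (σ s) := by
  have : ∀ s, ∃ t, ∀ (I) (k : ℕ), (E.blockList I)[k]? = some s → (F.blockList (h I))[k]? = some t := by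
    intro s
    obtain ⟨I, k, hs⟩ := exists_getElem_blockList s
    obtain ⟨hk, -⟩ := List.getElem?_eq_some_iff.1 hs
    rw [length_blockList, ← hsize, ← length_blockList] at hk
    refine ⟨(F.blockList (h I))[k], fun J m hm => ?_⟩
    obtain ⟨rfl, rfl⟩ := blockList_inj hs hm
    exact List.getElem?_eq_getElem hk
  choose σ hσ using this
  exact ⟨σ, fun I k s => hσ s I k⟩

/-- Symbols correspond by block and by place in the block. Being a right neighbour means holding the
next place in the same block, so adjacency is respected. -/
theorem exists_symbol_equiv {E F : FractalGasket}
    (h : {I : Finset (Fin E.N) // E.IsHorizontalBlock I} ≃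
      {J : Finset (Fin F.N) // F.IsHorizontalBlock J})
    (hsize : ∀ I, (h I).1.card = I.1.card) :
    ∃ σ : Fin E.N ≃ Fin F.N, (∀ s t, E.Adj s t ↔ F.Adj (σ s) (σ t)) ∧
      ∀ (I) (k : ℕ) (s), (E.blockList I)[k]? = some s → (F.blockList (h I))[k]? = some (σ s) := by
  obtain ⟨σ, hσ⟩ := exists_symbol_map h hsize
  obtain ⟨τ, hτ⟩ := exists_symbol_map h.symm fun J => by
    rw [← hsize, Equiv.apply_symm_apply]
  have h1 : ∀ s, τ (σ s) = s := by
    intro s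
    obtain ⟨I, k, hs⟩ := exists_getElem_blockList s
    have := hτ _ _ _ (hσ _ _ _ hs)
    rw [Equiv.symm_apply_apply, hs] at this
    exact (Option.some_injective _ this).symm
  have h2 : ∀ t, σ (τ t) = t := by
    intro t
    obtain ⟨I, k, ht⟩ := exists_getElem_blockList t
    have := hσ _ _ _ (hτ _ _ _ ht)
    rw [Equiv.apply_symm_apply, ht] at this
    exact (Option.some_injective _ this).symm
  refine ⟨⟨σ, τ, h1, h2⟩, fun s t => ?_, hσ⟩
  obtain ⟨I, k, hs⟩ := exists_getElem_blockList s
  have hs' := hσ _ _ _ hs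
  change _ ↔ F.Adj (σ s) (σ t)
  rw [adj_iff hs, adj_iff hs']
  refine ⟨fun h => hσ _ _ _ h, fun h => ?_⟩
  have := hτ _ _ _ h
  rwa [Equiv.symm_apply_apply, h1] at this

/-- The symbols of two gaskets with blocks of the same sizes correspond to each other. -/
theorem exists_symbol_equiv_of_blocks {E F : FractalGasket}
    (h : {I : Finset (Fin E.N) // E.IsHorizontalBlock I} ≃
      {J : Finset (Fin F.N) // F.IsHorizontalBlock J})
    (hsize : ∀ I, (h I).1.card = I.1.card)
    {I : Finset (Fin E.N)} (hI : E.IsHorizontalBlock I)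
    {J : Finset (Fin F.N)} (hJ : F.IsHorizontalBlock J) (hIJ : I.card = J.card)
    {α β : Fin E.N} {α' β' : Fin F.N} (hα : E.map α omegaAlpha = omegaAlpha)
    (hβ : E.map β omegaBeta = omegaBeta) (hα' : F.map α' omegaAlpha = omegaAlpha)
    (hβ' : F.map β' omegaBeta = omegaBeta) (hαI : α ∈ I) (hβI : β ∈ I) (hαJ : α' ∈ J)
    (hβJ : β' ∈ J) :
    ∃ σ : Fin E.N ≃ Fin F.N, (∀ s t, E.Adj s t ↔ F.Adj (σ s) (σ t)) ∧ σ α = α' ∧ σ β = β' := by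
  classical
  -- The given bijection need not match the two `αβ`-blocks. Swapping two blocks of equal size on
  -- the side of `F` corrects this; then the first symbols `α` and the last symbols `β` correspond.
  obtain ⟨σ, h1, h2⟩ := exists_symbol_equiv (h.trans (Equiv.swap (h ⟨I, hI⟩) ⟨J, hJ⟩)) fun L => by
    rw [Equiv.trans_apply, Equiv.swap_apply_def]
    split_ifs with e1 e2
    · obtain rfl := h.injective e1
      exact hIJ.symm
    · rw [hsize, ← hsize L, e2]; exact hIJ
    · exact hsize L
  have hhI : (h.trans (Equiv.swap (h ⟨I, hI⟩) ⟨J, hJ⟩)) ⟨I, hI⟩ = ⟨J, hJ⟩ := by simp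
  refine ⟨σ, h1, ?_, ?_⟩
  · have e1 := h2 _ _ _ (getElem_alpha (I := ⟨I, hI⟩) hα hαI)
    rw [hhI, getElem_alpha (I := ⟨J, hJ⟩) hα' hαJ] at e1
    exact (Option.some_injective _ e1).symm
  · have e1 := h2 _ _ _ (getElem_beta (I := ⟨I, hI⟩) hβ hβI)
    have e2 := getElem_beta (I := ⟨J, hJ⟩) hβ' hβJ
    rw [hhI] at e1
    simp only [hIJ] at e1 e2
    rw [e2] at e1
    exact (Option.some_injective _ e1).symm

end FractalGasket

/-! ### From codings with the same nearness relation to bi-Hölder maps. -/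

theorem near_comp_equiv {S T : Type*} (σ : S ≃ T) {C : S → S → S → S → Prop}
    {D : T → T → T → T → Prop} (h : ∀ s a t b, C s a t b ↔ D (σ s) (σ a) (σ t) (σ b)) (n : ℕ)
    (x y : ℕ → S) : near C n x y ↔ near D n (σ ∘ x) (σ ∘ y) := by
  induction n generalizing x y with
  | zero => exact Iff.rfl
  | succ n ih =>
    refine or_congr (and_congr σ.injective.eq_iff.symm (ih _ _)) ?_
    have hrun : ∀ a x, run a n (wtail x) ↔ run (σ a) n (wtail (σ ∘ x)) := fun a x =>
      forall₂_congr fun k _ => σ.injective.eq_iff.symm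
    constructor
    · rintro ⟨a, b, hc, ha, hb⟩
      exact ⟨σ a, σ b, (h _ _ _ _).1 hc, (hrun _ _).1 ha, (hrun _ _).1 hb⟩
    · rintro ⟨a, b, hc, ha, hb⟩
      obtain ⟨a, rfl⟩ := σ.surjective a
      obtain ⟨b, rfl⟩ := σ.surjective b
      exact ⟨a, b, (h _ _ _ _).2 hc, (hrun _ _).2 ha, (hrun _ _).2 hb⟩

section Holder

/-- Compare at the first level `n + 1` where nearness fails: the distance in `X` is at least of
order `ρ ^ n`, the one in `Y` at most of order `R ^ n ≤ (ρ ^ s) ^ n`. If nearness never fails, the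
points of `Y` coincide. -/
theorem dist_le_rpow_of_codings {W X Y : Type*} [MetricSpace X] [MetricSpace Y]
    {nr : ℕ → W → W → Prop} (h0 : ∀ x y, nr 0 x y) {b : W → X} {b' : W → Y} {c C ρ R s : ℝ}
    (hc : 0 < c) (hC : 0 < C) (hρ : 0 < ρ) (hR : 0 < R) (hR1 : R < 1) (hs : 0 < s)
    (hRρ : R ≤ ρ ^ s)
    (hX : ∀ n x y, ¬ nr n x y → c * ρ ^ n ≤ dist (b x) (b y))
    (hY : ∀ n x y, nr n x y → dist (b' x) (b' y) ≤ C * R ^ n) :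
    ∃ D > 0, ∀ x y, dist (b' x) (b' y) ≤ D * dist (b x) (b y) ^ s := by
  classical
  refine ⟨C / (c * ρ) ^ s, by positivity, fun x y => ?_⟩
  by_cases h : ∃ n, ¬ nr n x y
  · obtain ⟨n, hn⟩ : ∃ n, Nat.find h = n + 1 := by
      refine ⟨Nat.find h - 1, ?_⟩
      have : Nat.find h ≠ 0 := fun e => Nat.find_spec h (e ▸ h0 x y)
      omega
    have h1 : ¬ nr (n + 1) x y := hn ▸ Nat.find_spec h
    have h2 : nr n x y := not_not.1 (Nat.find_min h (by omega))
    have h3 := hX _ _ _ h1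
    have h4 : (c * ρ * ρ ^ n) ^ s ≤ dist (b x) (b y) ^ s :=
      Real.rpow_le_rpow (by positivity) (by rw [pow_succ] at h3; linarith) hs.le
    rw [Real.mul_rpow (by positivity) (by positivity), ← Real.rpow_natCast, ← Real.rpow_mul hρ.le,
      mul_comm (n : ℝ), Real.rpow_mul hρ.le, Real.rpow_natCast] at h4
    have h5 : R ^ n ≤ (ρ ^ s) ^ n := pow_le_pow_left₀ hR.le hRρ n
    have h6 : 0 < (c * ρ) ^ s := by positivity
    calc dist (b' x) (b' y) ≤ C * R ^ n := hY _ _ _ h2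
      _ ≤ C * (ρ ^ s) ^ n := by gcongr
      _ = C / (c * ρ) ^ s * ((c * ρ) ^ s * (ρ ^ s) ^ n) := by field_simp
      _ ≤ _ := by gcongr
  · push Not at h
    have : dist (b' x) (b' y) = 0 := eq_zero_of_forall_le_pow dist_nonneg hR.le hR1 fun n => by
      rw [mul_comm]; exact hY n x y (h n)
    rw [this]
    positivity

/-- The estimates in both directions show that the codings identify the same pairs of words, so `b'
∘ b⁻¹` is a well-defined bijection; the estimates then carry over to it. -/
theorem exists_isBiHolder_of_codings {W X Y : Type*} [MetricSpace X] [MetricSpace Y]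
    {nr : ℕ → W → W → Prop} (h0 : ∀ x y, nr 0 x y) {b : W → X} {b' : W → Y}
    (hb : Function.Surjective b) (hb' : Function.Surjective b') {c C ρ R c' C' ρ' R' s : ℝ}
    (hc : 0 < c) (hC : 0 < C) (hρ : 0 < ρ) (hR : 0 < R) (hR1 : R < 1)
    (hc' : 0 < c') (hC' : 0 < C') (hρ' : 0 < ρ') (hR' : 0 < R') (hR1' : R' < 1)
    (hs : 0 < s) (hRρ : R ≤ ρ' ^ s) (hRρ' : R' ≤ ρ ^ s)
    (hX : ∀ n x y, nr n x y → dist (b x) (b y) ≤ C * R ^ n)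
    (hX' : ∀ n x y, ¬ nr n x y → c * ρ ^ n ≤ dist (b x) (b y))
    (hY : ∀ n x y, nr n x y → dist (b' x) (b' y) ≤ C' * R' ^ n)
    (hY' : ∀ n x y, ¬ nr n x y → c' * ρ' ^ n ≤ dist (b' x) (b' y)) :
    ∃ f : X → Y, IsBiHolder s f := by
  obtain ⟨D, hD, h1⟩ := dist_le_rpow_of_codings h0 hc hC' hρ hR' hR1' hs hRρ' hX' hY
  obtain ⟨D', hD', h2⟩ := dist_le_rpow_of_codings h0 hc' hC hρ' hR hR1 hs hRρ hY' hX
  have e1 : ∀ x y, b x = b y → b' x = b' y := fun x y h => by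
    have := h1 x y
    rw [h, dist_self, Real.zero_rpow hs.ne', mul_zero] at this
    exact dist_le_zero.1 this
  have e2 : ∀ x y, b' x = b' y → b x = b y := fun x y h => by
    have := h2 x y
    rw [h, dist_self, Real.zero_rpow hs.ne', mul_zero] at this
    exact dist_le_zero.1 this
  choose a ha using hb
  have hf : ∀ x, b' (a (b x)) = b' x := fun x => e1 _ _ (ha _)
  refine ⟨fun p => b' (a p), ⟨fun p q h => ?_, fun q => ?_⟩, max D (D' ^ (1 / s)),
    lt_max_of_lt_left hD, fun p q => ⟨?_, ?_⟩⟩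
  · have := e2 _ _ h
    rwa [ha, ha] at this
  · obtain ⟨x, rfl⟩ := hb' q
    exact ⟨b x, hf x⟩
  · have h3 := h2 (a p) (a q)
    rw [ha, ha] at h3
    have h4 := Real.rpow_le_rpow dist_nonneg h3 (one_div_pos.2 hs).le
    rw [Real.mul_rpow hD'.le (by positivity), ← Real.rpow_mul dist_nonneg, mul_one_div_cancel hs.ne',
      Real.rpow_one] at h4
    have hm : 0 < max D (D' ^ (1 / s)) := lt_max_of_lt_left hD
    rw [inv_mul_le_iff₀ hm]
    exact h4.trans (mul_le_mul_of_nonneg_right (le_max_right _ _) dist_nonneg)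
  · have h3 := h1 (a p) (a q)
    rw [ha, ha] at h3
    exact h3.trans (mul_le_mul_of_nonneg_right (le_max_left _ _) (by positivity))

theorem exists_le_rpow {ρ R : ℝ} (hρ : 0 < ρ) (hρ1 : ρ < 1) (hR : 0 < R) (hR1 : R < 1) :
    ∃ s : ℝ, 0 < s ∧ ∀ t ≤ s, R ≤ ρ ^ t := by
  refine ⟨Real.logb ρ R, Real.logb_pos_of_base_lt_one hρ hρ1 hR hR1, fun t ht => ?_⟩
  calc R = ρ ^ Real.logb ρ R := (Real.rpow_logb hρ hρ1.ne hR).symm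
    _ ≤ ρ ^ t := Real.rpow_le_rpow_of_exponent_ge hρ hρ1.le ht

theorem IsBiHolder.continuous {X Y : Type*} [MetricSpace X] [MetricSpace Y] {s : ℝ} (hs : 0 < s)
    {f : X → Y} (hf : IsBiHolder s f) : Continuous f := by
  obtain ⟨-, C, hC, h⟩ := hf
  rw [continuous_iff_continuousAt]
  intro x
  rw [ContinuousAt, tendsto_iff_dist_tendsto_zero]
  have hcont : Continuous fun y : X => C * dist y x ^ s :=
    continuous_const.mul ((continuous_id.dist continuous_const).rpow_const fun _ => Or.inr hs.le)
  have hlim := hcont.tendsto x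
  rw [dist_self, Real.zero_rpow hs.ne', mul_zero] at hlim
  exact squeeze_zero (fun _ => dist_nonneg) (fun y => (h y x).2) hlim

theorem IsBiHolder.nonempty_homeomorph {X Y : Type*} [MetricSpace X] [MetricSpace Y]
    [CompactSpace X] {s : ℝ} (hs : 0 < s) {f : X → Y} (hf : IsBiHolder s f) : Nonempty (X ≃ₜ Y) :=
  ⟨Continuous.homeoOfEquivCompactToT2 (f := Equiv.ofBijective f hf.1) (hf.continuous hs)⟩

end Holder

/-! ### Assembly of the theorem. -/

theorem exists_isBiHolder_carrier {E F : FractalGasket}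
    (hE : E.MemClassTAlphaBeta) (hF : F.MemClassTAlphaBeta)
    (h : {I : Finset (Fin E.N) // E.IsHorizontalBlock I} ≃
      {J : Finset (Fin F.N) // F.IsHorizontalBlock J})
    (hsize : ∀ I, (h I).1.card = I.1.card)
    {I : Finset (Fin E.N)} (hI : E.IsAlphaBetaBlock I)
    {J : Finset (Fin F.N)} (hJ : F.IsAlphaBetaBlock J)
    (hIJ : I.card = J.card) {ρ R ρ' R' s : ℝ} (hρ0 : 0 < ρ) (hR1 : R < 1)
    (hρ : ∀ j, ρ ≤ E.ratio j) (hR : ∀ j, E.ratio j ≤ R) (hρ0' : 0 < ρ') (hR1' : R' < 1)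
    (hρ' : ∀ j, ρ' ≤ F.ratio j) (hR' : ∀ j, F.ratio j ≤ R') (hs : 0 < s)
    (hRρ : R ≤ ρ' ^ s) (hRρ' : R' ≤ ρ ^ s) :
    ∃ f : E.carrier → F.carrier, IsBiHolder s f := by
  obtain ⟨hIb, ⟨α, hαI, hα⟩, β, hβI, hβ⟩ := hI
  obtain ⟨hJb, ⟨α', hαJ, hα'⟩, β', hβJ, hβ'⟩ := hJ
  obtain ⟨σ, hσ, rfl, rfl⟩ := FractalGasket.exists_symbol_equiv_of_blocks h hsize hIb hJb hIJ
    hα hβ hα' hβ' hαI hβI hαJ hβJ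
  obtain ⟨b, hb, C, hC, c, hc, h1, h2⟩ :=
    FractalGasket.exists_metric_coding hE.1 hα hβ hρ0 hR1 hρ hR
  obtain ⟨b', hb', C', hC', c', hc', h1', h2'⟩ :=
    FractalGasket.exists_metric_coding hF.1 hα' hβ' hρ0' hR1' hρ' hR'
  have hnear := near_comp_equiv σ (C := E.Horizontal α β) (D := F.Horizontal (σ α) (σ β))
    fun s a t b => by simp only [FractalGasket.Horizontal, σ.injective.eq_iff, hσ]
  refine exists_isBiHolder_of_codings (nr := near (E.Horizontal α β)) (fun _ _ => trivial)
    (b' := fun x => b' (σ ∘ x)) hb ?_ hc hC hρ0 (hρ0.trans_le ((hρ α).trans (hR α))) hR1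
    hc' hC' hρ0' (hρ0'.trans_le ((hρ' (σ α)).trans (hR' (σ α)))) hR1' hs hRρ hRρ' h1 h2
    (fun n x y h => h1' n _ _ ((hnear n x y).1 h))
    (fun n x y h => h2' n _ _ fun h' => h ((hnear n x y).2 h'))
  intro q
  obtain ⟨x, rfl⟩ := hb' q
  refine ⟨σ.symm ∘ x, ?_⟩
  simp [← Function.comp_assoc]

theorem theorem1p4 (E F : FractalGasket)
    (hE : E.MemClassTAlphaBeta) (hF : F.MemClassTAlphaBeta)
    (h : {I : Finset (Fin E.N) // E.IsHorizontalBlock I} ≃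
      {J : Finset (Fin F.N) // F.IsHorizontalBlock J})
    (hsize : ∀ I, (h I).1.card = I.1.card)
    (I : Finset (Fin E.N)) (hI : E.IsAlphaBetaBlock I)
    (J : Finset (Fin F.N)) (hJ : F.IsAlphaBetaBlock J)
    (hIJ : I.card = J.card) :
    HolderEquivalent E.carrier F.carrier ∧
      Nonempty (E.carrier ≃ₜ F.carrier) ∧
      ∀ r : ℝ, (∀ i, E.ratio i = r) → (∀ j, F.ratio j = r) →
        LipschitzEquivalent E.carrier F.carrier := by
  obtain ⟨R, hR0, hR1, hR⟩ := E.exists_ratio_le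
  obtain ⟨ρ, hρ0, hρ1, hρ⟩ := E.exists_le_ratio
  obtain ⟨R', hR0', hR1', hR'⟩ := F.exists_ratio_le
  obtain ⟨ρ', hρ0', hρ1', hρ'⟩ := F.exists_le_ratio
  obtain ⟨s₁, hs₁, h₁⟩ := exists_le_rpow hρ0' hρ1' hR0 hR1
  obtain ⟨s₂, hs₂, h₂⟩ := exists_le_rpow hρ0 hρ1 hR0' hR1'
  have hs : 0 < min s₁ s₂ := lt_min hs₁ hs₂
  obtain ⟨f, hf⟩ := exists_isBiHolder_carrier hE hF h hsize hI hJ hIJ hρ0 hR1 hρ hR hρ0' hR1' hρ' hR'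
    hs (h₁ _ (min_le_left _ _)) (h₂ _ (min_le_right _ _))
  have : CompactSpace E.carrier := isCompact_iff_compactSpace.1 E.carrier_compact
  refine ⟨⟨f, _, hs, hf⟩, hf.nonempty_homeomorph hs, fun r hr hr' => ?_⟩
  obtain ⟨α, -⟩ := hI.2.1
  have hr0 : 0 < r := hr α ▸ E.ratio_pos α
  have hr1 : r < 1 := hr α ▸ E.ratio_lt_one α
  -- With one common ratio, all four bounds can be taken to be `r`, and the condition on the
  -- exponent holds for `s = 1`.
  exact exists_isBiHolder_carrier hE hF h hsize hI hJ hIJ hr0 hr1 (fun j => (hr j).ge)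
    (fun j => (hr j).le) hr0 hr1 (fun j => (hr' j).ge) (fun j => (hr' j).le) one_pos
    (Real.rpow_one r).ge (Real.rpow_one r).ge
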